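/- A (reduced) bumpless pipe dream of size $n$ is a tiling of the $n\times n$ grid (matrix coordinates, row $1$ on top) by the six tiles: blank, horizontal, vertical, cross, r (joining the south and east edges) and j (joining the west and north edges), such that the tiles form $n$ pipes, each starting vertically at the south edge of the grid and ending horizontally at the east edge, and no two pipes cross twice. Label the pipes $1,\dots,n$ from left to right along the south edge; $\mathrm{BPD}(\pi)$ is the set of bumpless pipe dreams whose pipe labels along the east edge, read from top to bottom, are $\pi(1),\dots,\pi(n)$. Let $t_{a,b}$ be the transposition of $a$ and $b$, let $\gtrdot$ be the covering relation of the Bruhat order on $S_n$, and put $$\mathfrak S_\pi(\mathbf x)=\sum_{D\in\mathrm{BPD}(\pi)}\ \prod_{(i,j)\text{ a blank tile of }D}x_i\in\mathbb Z[x_1,\dots,x_n].$$ **Theorem.** Let $\pi\in S_n$ and $1\le\alpha<n$ be such that $\pi t_{\alpha,l}\gtrdot\pi$ for some $l>\alpha$. Then there exists a bijection $$\Phi_\pi:\ \mathrm{BPD}(\pi)\ \sqcup\coprod_{\substack{k<\alpha\\ \pi t_{k,\alpha}\gtrdot\pi}}\mathrm{BPD}(\pi t_{k,\alpha})\ \longrightarrow\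 \coprod_{\substack{l>\alpha\\ \pi t_{\alpha,l}\gtrdot\pi}}\mathrm{BPD}(\pi t_{\alpha,l})$$ such that for every $D\in\mathrm{BPD}(\pi)$, $\Phi_\pi(D)$ has the same number of blank tiles as $D$ in each row other than row $\alpha$ and exactly one more blank tile than $D$ in row $\alpha$, and for every $D$ in one of the sets $\mathrm{BPD}(\pi t_{k,\alpha})$, $\Phi_\pi(D)$ has the same number of blank tiles as $D$ in every row. Consequently Monk's rule holds in the form $$x_\alpha\,\mathfrak S_\pi(\mathbf x)+\sum_{\substack{k<\alpha\\ \pi t_{k,\alpha}\gtrdot\pi}}\mathfrak S_{\pi t_{k,\alpha}}(\mathbf x)=\sum_{\substack{l>\alpha\\ \pi t_{\alpha,l}\gtrdot\pi}}\mathfrak S_{\pi t_{\alpha,l}}(\mathbf x).$$ -/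

import Mathlib

/-- The six tiles of a bumpless pipe dream. The tile `r` joins the south edge of its cell to the
east edge, the tile `j` joins the west edge to the north edge; `horiz` and `vert` are the straight
tiles and `cross` is the "+"-tile. The bump tile (an `r` and a `j` in one cell) is not allowed. -/
inductive BPDTile : Type
  | blank
  | cross
  | horiz
  | vert
  | r
  | j
  deriving DecidableEq

instance : Fintype BPDTile where
  elems := {.blank, .cross, .horiz, .vert, .r, .j}
  complete := by intro t; cases t <;> decide

namespace BPDTile

/-- Some pipe uses the north edge of the tile. -/
def north : BPDTile → Bool
  | cross => true
  | vert => true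
  | j => true
  | _ => false

/-- Some pipe uses the south edge of the tile. -/
def south : BPDTile → Bool
  | cross => true
  | vert => true
  | r => true
  | _ => false

/-- Some pipe uses the east edge of the tile. -/
def east : BPDTile → Bool
  | cross => true
  | horiz => true
  | r => true
  | _ => false

/-- Some pipe uses the west edge of the tile. -/
def west : BPDTile → Bool
  | cross => true
  | horiz => true
  | j => true
  | _ => false

end BPDTile

/-- A filling of the `n × n` grid by tiles. Cells carry matrix coordinates: `T i j` is the tile in
row `i` (counted from the top) and column `j` (counted from the left). -/
abbrev BPDTiling (n : ℕ) : Type := Fin n → Fin n → BPDTile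

namespace BPDTiling

variable {n : ℕ}

/-- The tiles fit together and form a family of `n` pipes, each starting vertically at the south
edge of the grid and ending horizontally at the east edge: pipe segments match across the common
edge of neighbouring cells, every edge on the south and east sides of the grid is used by a pipe,
and no edge on the north and west sides is. -/
structure IsPipeTiling (T : BPDTiling n) : Prop where
  match_horizontal : ∀ i j j' : Fin n, (j : ℕ) + 1 = j' → (T i j).east = (T i j').west
  match_vertical : ∀ i i' j : Fin n, (i : ℕ) + 1 = i' → (T i j).south = (T i' j).north
  south_side : ∀ i j : Fin n, (i : ℕ) + 1 = n → (T i j).south = true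
  east_side : ∀ i j : Fin n, (j : ℕ) + 1 = n → (T i j).east = true
  north_side : ∀ i j : Fin n, (i : ℕ) = 0 → (T i j).north = false
  west_side : ∀ i j : Fin n, (j : ℕ) = 0 → (T i j).west = false

/-- The side from which a pipe, followed from south to east, enters a cell. -/
inductive Entry : Type
  | fromSouth
  | fromWest

/-- `T.Enters p i j e`: the pipe with label `p`, i.e. the one that starts at the south edge of the
grid in column `p`, enters the cell `(i, j)` from the side `e` when it is followed from the south
edge towards the east edge. -/
inductive Enters (T : BPDTiling n) (p : Fin n) : Fin n → Fin n → Entry → Prop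
  | start (i : Fin n) (hi : (i : ℕ) + 1 = n) : Enters T p i p Entry.fromSouth
  | up (i i' j : Fin n) (hi : (i' : ℕ) + 1 = i) (h : Enters T p i j Entry.fromSouth)
      (ht : T i j = BPDTile.vert ∨ T i j = BPDTile.cross) : Enters T p i' j Entry.fromSouth
  | turnRight (i j j' : Fin n) (hj : (j : ℕ) + 1 = j') (h : Enters T p i j Entry.fromSouth)
      (ht : T i j = BPDTile.r) : Enters T p i j' Entry.fromWest
  | right (i j j' : Fin n) (hj : (j : ℕ) + 1 = j') (h : Enters T p i j Entry.fromWest)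
      (ht : T i j = BPDTile.horiz ∨ T i j = BPDTile.cross) : Enters T p i j' Entry.fromWest
  | turnUp (i i' j : Fin n) (hi : (i' : ℕ) + 1 = i) (h : Enters T p i j Entry.fromWest)
      (ht : T i j = BPDTile.j) : Enters T p i' j Entry.fromSouth

/-- The pipe `p` leaves the grid through the east edge in row `i`. -/
def ExitsAt (T : BPDTiling n) (p i : Fin n) : Prop :=
  ∃ j : Fin n, (j : ℕ) + 1 = n ∧
    ((T.Enters p i j Entry.fromSouth ∧ T i j = BPDTile.r) ∨
      (T.Enters p i j Entry.fromWest ∧ (T i j = BPDTile.horiz ∨ T i j = BPDTile.cross)))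

/-- The pipes `p` and `q` cross in the cell `(i, j)`. -/
def CrossAt (T : BPDTiling n) (p q i j : Fin n) : Prop :=
  T i j = BPDTile.cross ∧
    ((T.Enters p i j Entry.fromSouth ∧ T.Enters q i j Entry.fromWest) ∨
      (T.Enters q i j Entry.fromSouth ∧ T.Enters p i j Entry.fromWest))

/-- A (reduced) bumpless pipe dream: a tiling by pipes in which no two pipes cross twice. -/
structure IsBPD (T : BPDTiling n) : Prop extends IsPipeTiling T where
  reduced : ∀ p q : Fin n, p ≠ q → ∀ i j i' j' : Fin n,
    T.CrossAt p q i j → T.CrossAt p q i' j' → i = i' ∧ j = j'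

/-- The number of blank tiles in row `i`. -/
def rowBlanks (T : BPDTiling n) (i : Fin n) : ℕ :=
  (Finset.univ.filter fun j : Fin n => T i j = BPDTile.blank).card

/-- The set of positions of the blank tiles. -/
def blank (T : BPDTiling n) : Finset (Fin n × Fin n) :=
  Finset.univ.filter fun c : Fin n × Fin n => T c.1 c.2 = BPDTile.blank

end BPDTiling

/-- `BPD π`: the bumpless pipe dreams of the permutation `π`, i.e. those for which the labels of the
pipes, read along the east edge from top to bottom, are `π 1, …, π n`. -/
def BPD {n : ℕ} (π : Equiv.Perm (Fin n)) : Set (BPDTiling n) :=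
  {T | T.IsBPD ∧ ∀ i : Fin n, T.ExitsAt (π i) i}

open Classical in
/-- The (single) Schubert polynomial of `π`, computed with bumpless pipe dreams. -/
noncomputable def bpdSchubert {n : ℕ} (π : Equiv.Perm (Fin n)) : MvPolynomial (Fin n) ℤ :=
  ∑ D ∈ Finset.univ.filter (fun D : BPDTiling n => D ∈ BPD π),
    ∏ c ∈ D.blank, MvPolynomial.X c.1

/-- The Coxeter length of a permutation: its number of inversions. -/
def permLength {n : ℕ} (π : Equiv.Perm (Fin n)) : ℕ :=
  (Finset.univ.filter fun c : Fin n × Fin n => c.1 < c.2 ∧ π c.2 < π c.1).card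

/-- The strict Bruhat order on `Sₙ`: the transitive closure of the relations `u < u t` with `t` a
transposition such that the length of `u t` exceeds the length of `u`. -/
def BruhatLT {n : ℕ} : Equiv.Perm (Fin n) → Equiv.Perm (Fin n) → Prop :=
  Relation.TransGen fun u v =>
    ∃ a b : Fin n, a ≠ b ∧ v = u * Equiv.swap a b ∧ permLength u < permLength v

/-- The covering relation of the Bruhat order: `BruhatCovBy u v` means `v ⋗ u`. -/
def BruhatCovBy {n : ℕ} (u v : Equiv.Perm (Fin n)) : Prop :=
  BruhatLT u v ∧ ¬ ∃ w, BruhatLT u w ∧ BruhatLT w v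

/-! The polynomial identity is proved without a map between pipe dreams. Both sides are sums of
monomials with coefficient 1, so equal coefficients mean equinumerous fibres and a bijection
preserving row counts exists (`exists_equiv_of_sum_monomial_eq`); it is not explicit.

The generating function is the partition function of a lattice model. Cells are read row by row from
the bottom, each row from left to right; the labels on the frontier form a word, and a cell acts on
two neighbouring letters by `cellOp`. Reducedness becomes local: at each crossing the smaller label
comes from the west (`reduced_iff`). A Yang–Baxter equation (`braidOp_cellOp_cellOp`) exchanges the
weights of two adjacent rows. The braid is trivial on the empty west side and permutes labels on the
east side. With s exchanging i and i+1 this gives `bpdSum_swap`: S_π(x) = S_π(sx) + [π(i) > π(i+1)]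
(x_i − x_{i+1}) S_{πs}(sx).

The difference of the two sides of Monk's rule, `monkDefect`, obeys the same recursion, with (π, a)
replaced by (πs, s(a)) in the correction term (`monkDefect_swap`): s transports covers, except at
the pair (i, i+1), which accounts for x_a turning into x_{s(a)}. By induction on the length the
correction vanishes, so the defect is symmetric. It does not involve the last variable, since the
last row has no blanks and α is not the last row. Hence it is constant, and it is zero at the origin
because only the identity has a pipe dream without blanks. -/

/-! ### Local operators on functions of words -/

section WordOperators

variable {R : Type*} [CommRing R]

/-- Exchange the letters of a word at the positions `k` and `k + 1`. -/
def swapWord (k : ℕ) (F : ℕ → ℕ∞) : ℕ → ℕ∞ := F ∘ Equiv.swap k (k + 1)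

@[simp]
theorem swapWord_left (k : ℕ) (F : ℕ → ℕ∞) : swapWord k F k = F (k + 1) := by
  simp [swapWord]

@[simp]
theorem swapWord_right (k : ℕ) (F : ℕ → ℕ∞) : swapWord k F (k + 1) = F k := by
  simp [swapWord]

theorem swapWord_of_ne {k m : ℕ} (F : ℕ → ℕ∞) (h : m ≠ k) (h' : m ≠ k + 1) :
    swapWord k F m = F m := by
  simp [swapWord, Equiv.swap_apply_of_ne_of_ne h h']

@[simp]
theorem swapWord_swapWord (k : ℕ) (F : ℕ → ℕ∞) : swapWord k (swapWord k F) = F := by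
  funext m; simp [swapWord]

theorem swapWord_comm {k l : ℕ} (h : k + 1 < l) (F : ℕ → ℕ∞) :
    swapWord k (swapWord l F) = swapWord l (swapWord k F) := by
  funext m
  simp only [swapWord, Function.comp, Equiv.swap_apply_def]
  grind

theorem swapWord_braid (k : ℕ) (F : ℕ → ℕ∞) :
    swapWord k (swapWord (k + 1) (swapWord k F)) =
      swapWord (k + 1) (swapWord k (swapWord (k + 1) F)) := by
  funext m
  simp only [swapWord, Function.comp, Equiv.swap_apply_def]
  grind

/-- The operator that keeps or exchanges the letters at the positions `k` and `k + 1`, with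
coefficients depending on these two letters. -/
def localOp (c d : ℕ∞ → ℕ∞ → R) (k : ℕ) (φ : (ℕ → ℕ∞) → R) (F : ℕ → ℕ∞) : R :=
  c (F k) (F (k + 1)) * φ F + d (F k) (F (k + 1)) * φ (swapWord k F)

theorem localOp_comm (c d c' d' : ℕ∞ → ℕ∞ → R) {k l : ℕ} (h : k + 1 < l)
    (φ : (ℕ → ℕ∞) → R) :
    localOp c d k (localOp c' d' l φ) = localOp c' d' l (localOp c d k φ) := by
  funext F
  simp only [localOp, swapWord_comm h]
  rw [swapWord_of_ne (k := k) (m := l) F (by omega) (by omega),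
    swapWord_of_ne (k := k) (m := l + 1) F (by omega) (by omega),
    swapWord_of_ne (k := l) (m := k) F (by omega) (by omega),
    swapWord_of_ne (k := l) (m := k + 1) F (by omega) (by omega)]
  ring

open Classical in
/-- The coefficient with which a cell of weight `x` keeps the labels `w` and `s`. -/
noncomputable def turnCoeff (x : R) (w s : ℕ∞) : R :=
  -- Two pipes may not bounce off each other, as the bump tile is excluded; hence the final 0.
  if w = ⊤ ∧ s = ⊤ then x else if w = ⊤ ∨ s = ⊤ then 1 else 0

open Classical in
/-- The coefficient with which a cell exchanges the labels `w` and `s`. -/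
noncomputable def passCoeff (w s : ℕ∞) : R :=
  if w = ⊤ ∧ s = ⊤ then 0 else if w = ⊤ ∨ s = ⊤ then 1 else if w < s then 1 else 0

/-- The transfer operator of a cell whose west and south edges are the letters `k` and `k + 1`. -/
noncomputable def cellOp (k : ℕ) (x : R) : ((ℕ → ℕ∞) → R) → (ℕ → ℕ∞) → R :=
  localOp (turnCoeff x) passCoeff k

open Classical in
/-- The operator that intertwines two rows of cells, see `braidOp_cellOp_cellOp`. -/
noncomputable def braidOp (k : ℕ) (z : R) : ((ℕ → ℕ∞) → R) → (ℕ → ℕ∞) → R :=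
  localOp (fun _ _ => 1) (fun w s => if w < s then z else 0) k

/-- The Yang–Baxter equation. The outermost operator acts first on the word, so the braid sits on
the west edges of a column of two cells on one side of the equation and on their east edges on the
other. Only the order of three letters and which of them are `⊤` matter: a finite check. -/
theorem braidOp_cellOp_cellOp (k : ℕ) (x y : R) (φ : (ℕ → ℕ∞) → R) :
    braidOp k (x - y) (cellOp (k + 1) y (cellOp k x φ)) =
      cellOp (k + 1) x (cellOp k y (braidOp (k + 1) (x - y) φ)) := by
  funext F
  have e1 (G : ℕ → ℕ∞) : swapWord (k + 1) G k = G k :=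
    swapWord_of_ne G (by omega) (by omega)
  have e2 (G : ℕ → ℕ∞) : swapWord k G (k + 1 + 1) = G (k + 1 + 1) :=
    swapWord_of_ne G (by omega) (by omega)
  simp only [braidOp, cellOp, localOp, swapWord_left, swapWord_right, e1, e2, swapWord_swapWord,
    swapWord_braid]
  generalize F k = a, F (k + 1) = b, F (k + 1 + 1) = c
  generalize φ F = p0, φ (swapWord k F) = p1, φ (swapWord (k + 1) F) = p2,
    φ (swapWord k (swapWord (k + 1) F)) = p3, φ (swapWord (k + 1) (swapWord k F)) = p4,
    φ (swapWord (k + 1) (swapWord k (swapWord (k + 1) F))) = p5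
  rcases eq_or_ne a ⊤ with rfl | ha <;> rcases eq_or_ne b ⊤ with rfl | hb <;>
    rcases eq_or_ne c ⊤ with rfl | hc
  all_goals
    simp_all only [turnCoeff, passCoeff, not_top_lt, lt_top_iff_ne_top, ne_eq, not_false_eq_true,
      and_self, and_true, and_false, or_true, or_self, or_false, if_true, if_false,
      lt_self_iff_false]
  all_goals
    repeat' split_ifs
  all_goals first | (exfalso; order) | ring

/-- The transfer operator of a sequence of `m` cells. -/
noncomputable def cellsOp (pos : ℕ → ℕ) (x : ℕ → R) :
    ℕ → ((ℕ → ℕ∞) → R) → (ℕ → ℕ∞) → R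
  | 0, φ => φ
  | m + 1, φ => cellsOp pos x m (cellOp (pos m) (x m) φ)

theorem cellsOp_add (pos : ℕ → ℕ) (x : ℕ → R) (a b : ℕ) (φ : (ℕ → ℕ∞) → R) :
    cellsOp pos x (a + b) φ =
      cellsOp pos x a (cellsOp (fun k => pos (a + k)) (fun k => x (a + k)) b φ) := by
  induction b generalizing φ with
  | zero => rfl
  | succ b ih => exact ih _

theorem cellsOp_congr {pos pos' : ℕ → ℕ} {x x' : ℕ → R} {m : ℕ}
    (hp : ∀ k < m, pos k = pos' k) (hx : ∀ k < m, x k = x' k) (φ : (ℕ → ℕ∞) → R) :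
    cellsOp pos x m φ = cellsOp pos' x' m φ := by
  induction m generalizing φ with
  | zero => rfl
  | succ m ih =>
    simp only [cellsOp]
    rw [hp m (by omega), hx m (by omega)]
    exact ih (fun k hk => hp k (by omega)) (fun k hk => hx k (by omega)) _

theorem localOp_cellsOp_of_lt (c d : ℕ∞ → ℕ∞ → R) (p : ℕ) (pos : ℕ → ℕ) (x : ℕ → R) (m : ℕ)
    (h : ∀ k < m, p + 1 < pos k) (φ : (ℕ → ℕ∞) → R) :
    localOp c d p (cellsOp pos x m φ) = cellsOp pos x m (localOp c d p φ) := by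
  induction m generalizing φ with
  | zero => rfl
  | succ m ih =>
    simp only [cellsOp]
    rw [ih (fun k hk => h k (by omega)), cellOp, localOp_comm _ _ _ _ (h m (by omega))]

theorem localOp_cellsOp_of_gt (c d : ℕ∞ → ℕ∞ → R) (p : ℕ) (pos : ℕ → ℕ) (x : ℕ → R) (m : ℕ)
    (h : ∀ k < m, pos k + 1 < p) (φ : (ℕ → ℕ∞) → R) :
    localOp c d p (cellsOp pos x m φ) = cellsOp pos x m (localOp c d p φ) := by
  induction m generalizing φ with
  | zero => rfl
  | succ m ih =>
    simp only [cellsOp]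
    rw [ih (fun k hk => h k (by omega)), cellOp, localOp_comm _ _ _ _ (h m (by omega))]

/-- The transfer operator of a row of `m` cells whose first west edge is the letter `p`. -/
noncomputable def rowOp (p : ℕ) (x : R) (m : ℕ) : ((ℕ → ℕ∞) → R) → (ℕ → ℕ∞) → R :=
  cellsOp (fun j => p + j) (fun _ => x) m

/-- The last cell of the lower row shares no letter with the first `m` cells of the upper row, so
two rows can be read column by column. -/
theorem rowOp_succ_rowOp_succ (p : ℕ) (x y : R) (m : ℕ) (φ : (ℕ → ℕ∞) → R) :
    rowOp (p + 1) y (m + 1) (rowOp p x (m + 1) φ) =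
      rowOp (p + 1) y m (rowOp p x m (cellOp (p + m + 1) y (cellOp (p + m) x φ))) := by
  simp only [rowOp, cellsOp]
  congr 1
  rw [show p + 1 + m = p + m + 1 by omega]
  exact localOp_cellsOp_of_gt _ _ _ _ _ _ (fun k hk => by omega) _

/-- The braid is pushed through the two rows one column at a time. -/
theorem braidOp_rowOp_rowOp (p : ℕ) (x y : R) (m : ℕ) (φ : (ℕ → ℕ∞) → R) :
    braidOp p (x - y) (rowOp (p + 1) y m (rowOp p x m φ)) =
      rowOp (p + 1) x m (rowOp p y m (braidOp (p + m) (x - y) φ)) := by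
  induction m generalizing φ with
  | zero => rfl
  | succ m ih =>
    rw [rowOp_succ_rowOp_succ, rowOp_succ_rowOp_succ, ih, braidOp_cellOp_cellOp, ← add_assoc]

/-- The transfer operator of the `r` lowest rows of a grid with `n` rows and columns, where the
cells in row `i` have weight `x i`. -/
noncomputable def rowsOp (n : ℕ) (x : ℕ → R) : ℕ → ((ℕ → ℕ∞) → R) → (ℕ → ℕ∞) → R
  | 0, φ => φ
  | r + 1, φ => rowsOp n x r (rowOp (n - 1 - r) (x (n - 1 - r)) n φ)

theorem mul_add_div_of_lt {r n k : ℕ} (h : k < n) : (r * n + k) / n = r := by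
  rw [mul_comm, Nat.mul_add_div (by omega), Nat.div_eq_of_lt h, add_zero]

theorem rowsOp_eq_cellsOp (n : ℕ) (x : ℕ → R) (r : ℕ) (φ : (ℕ → ℕ∞) → R) :
    rowsOp n x r φ =
      cellsOp (fun k => n - 1 - k / n + k % n) (fun k => x (n - 1 - k / n)) (r * n) φ := by
  induction r generalizing φ with
  | zero => simp [rowsOp, cellsOp]
  | succ r ih =>
    rw [Nat.succ_mul, cellsOp_add, rowsOp, ih]
    congr 1
    refine cellsOp_congr (fun k hk => ?_) (fun k hk => ?_) φ
    · rw [mul_add_div_of_lt hk, Nat.mul_add_mod_of_lt hk]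
    · rw [mul_add_div_of_lt hk]

theorem rowsOp_congr {n : ℕ} {x y : ℕ → R} {r : ℕ} (h : ∀ i, n ≤ r + i → x i = y i)
    (hr : r ≤ n) (φ : (ℕ → ℕ∞) → R) : rowsOp n x r φ = rowsOp n y r φ := by
  induction r generalizing φ with
  | zero => rfl
  | succ r ih =>
    rw [rowsOp, rowsOp, h (n - 1 - r) (by omega), ih (fun i hi => h i (by omega)) (by omega)]

theorem localOp_rowsOp_of_lt (c d : ℕ∞ → ℕ∞ → R) {n p : ℕ} (x : ℕ → R) {r : ℕ}
    (h : p + 1 + r < n) (φ : (ℕ → ℕ∞) → R) :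
    localOp c d p (rowsOp n x r φ) = rowsOp n x r (localOp c d p φ) := by
  induction r generalizing φ with
  | zero => rfl
  | succ r ih =>
    rw [rowsOp, rowsOp, ih (by omega), rowOp, localOp_cellsOp_of_lt _ _ _ _ _ _ (by grind)]

/-- Exchanging the weights of two neighbouring rows. -/
theorem rowsOp_swap {n i : ℕ} (hi : i + 1 < n) (x : ℕ → R) {r : ℕ} (hr : n ≤ i + r)
    (hrn : r ≤ n) (φ : (ℕ → ℕ∞) → R) {F : ℕ → ℕ∞} (hF : F i = ⊤) :
    rowsOp n x r φ F =
      rowsOp n (x ∘ Equiv.swap i (i + 1)) r (braidOp (i + n) (x i - x (i + 1)) φ) F := by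
  induction r generalizing φ with
  | zero => omega
  | succ r ih =>
    rcases Nat.lt_or_ge (i + r) n with h | h
    · obtain ⟨r, rfl⟩ : ∃ q, r = q + 1 := ⟨r - 1, by omega⟩
      have h1 : n - 1 - (r + 1) = i := by omega
      have h2 : n - 1 - r = i + 1 := by omega
      simp only [rowsOp, h1, h2, Function.comp, Equiv.swap_apply_left, Equiv.swap_apply_right]
      -- Rows `i` and `i + 1` are the last two read. Moved to their west side and past the lower
      -- rows, the braid meets the initial word, whose letter `i` is `⊤`, so its exchange term
      -- vanishes.
      rw [← braidOp_rowOp_rowOp, braidOp, ← localOp_rowsOp_of_lt _ _ _ (by omega), localOp, hF]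
      simp only [not_top_lt, if_false, zero_mul, add_zero, one_mul]
      rw [rowsOp_congr _ (by omega)]
      intro j hj
      rw [Function.comp, Equiv.swap_apply_of_ne_of_ne (by omega) (by omega)]
    · have h1 : (x ∘ Equiv.swap i (i + 1)) (n - 1 - r) = x (n - 1 - r) := by
        rw [Function.comp, Equiv.swap_apply_of_ne_of_ne (by omega) (by omega)]
      -- A row above `i` only touches letters below `i + n`, so the braid commutes with it.
      rw [rowsOp, rowsOp, ih h (by omega), h1, braidOp, rowOp,
        localOp_cellsOp_of_gt _ _ _ _ _ _ (fun k hk => by omega)]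

end WordOperators

/-! ### The transfer operators as sums over sequences of tiles -/

namespace BPDTile

/-- The tile continues a path from west to east or from south to north, so that the labels of the
west and south edges reappear, in this order, on the east and north edges. -/
def passes : BPDTile → Bool
  | cross => true
  | horiz => true
  | vert => true
  | _ => false

/-- The tile fits to the labels `w` and `s` of its west and south edges, `⊤` meaning that no pipe
uses the edge. -/
def Carries (t : BPDTile) (w s : ℕ∞) : Prop :=
  (t.west = true ↔ w ≠ ⊤) ∧ (t.south = true ↔ s ≠ ⊤)

/-- The tile fits to the labels `w` and `s` of its west and south edges and the pipe with the
smaller label comes from the west if pipes cross. -/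
def Fits (t : BPDTile) (w s : ℕ∞) : Prop :=
  t.Carries w s ∧ (t = cross → w < s)

theorem sum_univ {M : Type*} [AddCommMonoid M] (f : BPDTile → M) :
    ∑ t, f t = f blank + (f cross + (f horiz + (f vert + (f r + f j)))) := by
  change ∑ t ∈ {blank, cross, horiz, vert, r, j}, f t = _
  simp

end BPDTile

section TileSequences

variable {R : Type*} [CommRing R]

open Classical in
theorem cellOp_eq_sum (k : ℕ) (x : R) (φ : (ℕ → ℕ∞) → R) (F : ℕ → ℕ∞) :
    cellOp k x φ F = ∑ t : BPDTile, if t.Fits (F k) (F (k + 1)) then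
      (if t = .blank then x else 1) * φ (if t.passes then swapWord k F else F) else 0 := by
  simp only [BPDTile.sum_univ, cellOp, localOp, turnCoeff, passCoeff, BPDTile.Fits,
    BPDTile.Carries, BPDTile.west, BPDTile.south, BPDTile.passes]
  by_cases h : F k = ⊤ <;> by_cases h' : F (k + 1) = ⊤ <;> by_cases h'' : F k < F (k + 1) <;>
    simp [h, h', h''] <;> simp_all [add_comm]

/-- The permutation of the positions of the letters of a word by a sequence of tiles, where the
`k`-th tile acts on the letters `pos k` and `pos k + 1`. -/
def routing (pos : ℕ → ℕ) (τ : ℕ → BPDTile) : ℕ → Equiv.Perm ℕ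
  | 0 => 1
  | k + 1 => if (τ k).passes then routing pos τ k * Equiv.swap (pos k) (pos k + 1)
      else routing pos τ k

theorem routing_congr {pos : ℕ → ℕ} {τ τ' : ℕ → BPDTile} {m : ℕ} (h : ∀ k < m, τ k = τ' k) :
    routing pos τ m = routing pos τ' m := by
  induction m with
  | zero => rfl
  | succ m ih => rw [routing, routing, h m (by omega), ih fun k hk => h k (by omega)]

theorem swapWord_comp_routing (pos : ℕ → ℕ) (τ : ℕ → BPDTile) (k : ℕ) (F : ℕ → ℕ∞) :
    (if (τ k).passes then swapWord (pos k) (F ∘ routing pos τ k) else F ∘ routing pos τ k) =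
      F ∘ routing pos τ (k + 1) := by
  rw [routing]
  split_ifs <;> rfl

/-- A finite sequence of tiles, continued by blanks. -/
def extendByBlank {m : ℕ} (τ : Fin m → BPDTile) (k : ℕ) : BPDTile :=
  if h : k < m then τ ⟨k, h⟩ else .blank

theorem extendByBlank_of_lt {m k : ℕ} (τ : Fin m → BPDTile) (h : k < m) :
    extendByBlank τ k = τ ⟨k, h⟩ := dif_pos h

theorem extendByBlank_snoc_of_lt {m k : ℕ} (τ : Fin m → BPDTile) (t : BPDTile) (h : k < m) :
    extendByBlank (Fin.snoc (α := fun _ => BPDTile) τ t) k = extendByBlank τ k := by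
  rw [extendByBlank_of_lt _ h, extendByBlank_of_lt _ (by omega : k < m + 1)]
  exact Fin.snoc_castSucc (α := fun _ => BPDTile) t τ ⟨k, h⟩

theorem extendByBlank_snoc_self {m : ℕ} (τ : Fin m → BPDTile) (t : BPDTile) :
    extendByBlank (Fin.snoc (α := fun _ => BPDTile) τ t) m = t := by
  rw [extendByBlank_of_lt _ (by omega : m < m + 1)]
  exact Fin.snoc_last (α := fun _ => BPDTile) t τ

/-- All tiles of a sequence fit when they act one after the other on a word. -/
def FitsAll (P : BPDTile → ℕ∞ → ℕ∞ → Prop) (pos : ℕ → ℕ) (τ : ℕ → BPDTile) (F : ℕ → ℕ∞)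
    (m : ℕ) : Prop :=
  ∀ k < m, P (τ k) (F (routing pos τ k (pos k))) (F (routing pos τ k (pos k + 1)))

theorem fitsAll_congr {P : BPDTile → ℕ∞ → ℕ∞ → Prop} {pos : ℕ → ℕ} {τ τ' : ℕ → BPDTile}
    {F : ℕ → ℕ∞} {m : ℕ} (h : ∀ k < m, τ k = τ' k) :
    FitsAll P pos τ F m ↔ FitsAll P pos τ' F m := by
  refine forall₂_congr fun k hk => ?_
  rw [h k hk, routing_congr fun l hl => h l (by omega)]

theorem fitsAll_succ {P : BPDTile → ℕ∞ → ℕ∞ → Prop} {pos : ℕ → ℕ} {τ : ℕ → BPDTile}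
    {F : ℕ → ℕ∞} {m : ℕ} :
    FitsAll P pos τ F (m + 1) ↔ FitsAll P pos τ F m ∧
      P (τ m) (F (routing pos τ m (pos m))) (F (routing pos τ m (pos m + 1))) :=
  Nat.forall_lt_succ_right

open Classical in
theorem cellsOp_eq_sum (pos : ℕ → ℕ) (x : ℕ → R) (m : ℕ) (φ : (ℕ → ℕ∞) → R) (F : ℕ → ℕ∞) :
    cellsOp pos x m φ F = ∑ τ : Fin m → BPDTile,
      if FitsAll BPDTile.Fits pos (extendByBlank τ) F m then
        (∏ k : Fin m, if τ k = .blank then x k else 1) *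
          φ (F ∘ routing pos (extendByBlank τ) m) else 0 := by
  induction m generalizing φ with
  | zero => simp [cellsOp, routing, FitsAll]
  | succ m ih =>
    rw [cellsOp, ih, ← (Fin.snocEquiv fun _ => BPDTile).sum_comp, Fintype.sum_prod_type_right]
    refine Finset.sum_congr rfl fun τ _ => ?_
    have h (t : BPDTile) (k : ℕ) (hk : k < m) := extendByBlank_snoc_of_lt τ t hk
    have hs (t : BPDTile) : (Fin.snocEquiv fun _ => BPDTile) (t, τ) =
        Fin.snoc (α := fun _ => BPDTile) τ t := rfl
    simp only [hs, fitsAll_succ, fitsAll_congr (h _), routing_congr (h _),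
      extendByBlank_snoc_self, ← swapWord_comp_routing, Fin.prod_univ_castSucc, Fin.snoc_castSucc,
      Fin.snoc_last, Fin.val_castSucc, Fin.val_last]
    by_cases hv : FitsAll BPDTile.Fits pos (extendByBlank τ) F m
    · simp only [hv, true_and, if_true, cellOp_eq_sum, Finset.mul_sum]
      refine Finset.sum_congr rfl fun t _ => ?_
      simp only [Function.comp, mul_ite, mul_zero]
      split_ifs <;> ring
    · simp [hv]

end TileSequences

/-! ### Labelling the edges of a tiling -/

theorem routing_apply_of_ne {pos : ℕ → ℕ} {τ : ℕ → BPDTile} {a b p : ℕ} (hab : a ≤ b)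
    (h : ∀ k, a ≤ k → k < b → pos k ≠ p ∧ pos k + 1 ≠ p) :
    routing pos τ b p = routing pos τ a p := by
  induction b, hab using Nat.le_induction with
  | base => rfl
  | succ b hb ih =>
    have h1 := h b hb (by omega)
    rw [routing, ← ih fun k hk hk' => h k hk (by omega)]
    split_ifs
    · rw [Equiv.Perm.mul_apply, Equiv.swap_apply_of_ne_of_ne h1.1.symm h1.2.symm]
    · rfl

/-- If the order of two letters is reversed, then they were exchanged at some step. -/
theorem exists_swap_of_reversed {pos : ℕ → ℕ} {τ : ℕ → BPDTile} {a b u v : ℕ} (hab : a ≤ b)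
    (ha : (routing pos τ a).symm u < (routing pos τ a).symm v)
    (hb : (routing pos τ b).symm v < (routing pos τ b).symm u) :
    ∃ k, a ≤ k ∧ k < b ∧ (τ k).passes = true ∧ routing pos τ k (pos k) = u ∧
      routing pos τ k (pos k + 1) = v := by
  induction b, hab using Nat.le_induction with
  | base => omega
  | succ b hab ih =>
    by_cases hlt : (routing pos τ b).symm v < (routing pos τ b).symm u
    · obtain ⟨k, h1, h2, h3⟩ := ih hlt
      exact ⟨k, h1, by omega, h3⟩
    · have hne : (routing pos τ b).symm v ≠ (routing pos τ b).symm u := by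
        intro h
        rw [(routing pos τ b).symm.injective h] at ha
        omega
      rw [routing] at hb
      split_ifs at hb with hp
      · refine ⟨b, hab, by omega, hp, ?_⟩
        -- Exchanging two neighbouring positions reverses only the pair of letters sitting there.
        rw [← Equiv.eq_symm_apply, ← Equiv.eq_symm_apply]
        simp only [← Equiv.Perm.inv_def, mul_inv_rev, Equiv.Perm.mul_apply, Equiv.swap_inv,
          Equiv.swap_apply_def] at hb hlt hne ⊢
        grind
      · exact absurd hb hlt

theorem reversed_of_swap {pos : ℕ → ℕ} {τ : ℕ → BPDTile} {k u v : ℕ}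
    (hp : (τ k).passes = true) (hu : routing pos τ k (pos k) = u)
    (hv : routing pos τ k (pos k + 1) = v) :
    (routing pos τ (k + 1)).symm v < (routing pos τ (k + 1)).symm u := by
  have h1 : (routing pos τ (k + 1)).symm v = pos k := by
    rw [Equiv.symm_apply_eq, routing, if_pos hp, Equiv.Perm.mul_apply, Equiv.swap_apply_left, hv]
  have h2 : (routing pos τ (k + 1)).symm u = pos k + 1 := by
    rw [Equiv.symm_apply_eq, routing, if_pos hp, Equiv.Perm.mul_apply, Equiv.swap_apply_right, hu]
  omega

/-- The letter of a frontier word on which the `k`-th cell of the grid acts, if the rows are read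
from bottom to top and every row from left to right. -/
def cellPos (n k : ℕ) : ℕ := n - 1 - k / n + k % n

theorem cellPos_mul_add {n r j : ℕ} (hj : j < n) : cellPos n (r * n + j) = n - 1 - r + j := by
  rw [cellPos, mul_add_div_of_lt hj, Nat.mul_add_mod_of_lt hj]

theorem exists_eq_mul_add {n k : ℕ} (hk : k < n * n) :
    ∃ r j, r < n ∧ j < n ∧ k = r * n + j := by
  have hn : 0 < n := by rcases n with _ | n <;> omega
  exact ⟨k / n, k % n, Nat.div_lt_of_lt_mul hk, Nat.mod_lt _ hn, (Nat.div_add_mod' k n).symm⟩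

/-- The labels along the west and south sides of the grid. -/
def startWord (n k : ℕ) : ℕ∞ := if k < n then ⊤ else ((k - n : ℕ) : ℕ∞)

/-- The labels along the north and east sides of the grid. -/
def endWord {n : ℕ} (π : Equiv.Perm (Fin n)) (k : ℕ) : ℕ∞ :=
  -- The default past `2 * n` agrees with `startWord`, because no cell touches these letters.
  if k < n then ⊤ else if h : k - n < n then ((π ⟨k - n, h⟩ : ℕ) : ℕ∞) else ((k - n : ℕ) : ℕ∞)

theorem startWord_eq_coe {n k p : ℕ} : startWord n k = p ↔ k = n + p := by
  rw [startWord]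
  split_ifs with h
  · simp; omega
  · rw [Nat.cast_inj]; omega

/-- Tilings as sequences of tiles, the rows being read from bottom to top. -/
def tilingEquiv (n : ℕ) : BPDTiling n ≃ (Fin (n * n) → BPDTile) where
  toFun T k := T k.divNat.rev k.modNat
  invFun τ i j := τ (finProdFinEquiv (i.rev, j))
  left_inv T := by
    funext i j
    have h := finProdFinEquiv.symm_apply_apply (i.rev, j)
    rw [finProdFinEquiv_symm_apply, Prod.mk.injEq] at h
    simp only [h.1, h.2, Fin.rev_rev]
  right_inv τ := by
    funext k
    have h := finProdFinEquiv.apply_symm_apply k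
    rw [finProdFinEquiv_symm_apply] at h
    simp only [Fin.rev_rev, h]

namespace BPDTiling

variable {n : ℕ} (T : BPDTiling n)

/-- The tiles in the order in which they are read. -/
def tileSeq : ℕ → BPDTile := extendByBlank (tilingEquiv n T)

theorem tileSeq_mul_add {r j : ℕ} (hr : r < n) (hj : j < n) :
    T.tileSeq (r * n + j) = T ⟨n - 1 - r, by omega⟩ ⟨j, hj⟩ := by
  have h : r * n + j < n * n := by nlinarith
  rw [tileSeq, extendByBlank_of_lt _ h]
  change T (Fin.rev _) _ = _
  congr 1
  · simp only [Fin.ext_iff, Fin.val_rev, Fin.divNat, mul_add_div_of_lt hj]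
    omega
  · simp only [Fin.modNat, Nat.mul_add_mod_of_lt hj]

/-- The permutation of the letters of the frontier word after `k` cells. -/
def route (k : ℕ) : Equiv.Perm ℕ := routing (cellPos n) T.tileSeq k

/-- The letter `p` of the frontier word after `k` cells. -/
def label (k p : ℕ) : ℕ∞ := startWord n (T.route k p)

theorem label_eq_of_ne {a b p : ℕ} (hab : a ≤ b)
    (h : ∀ k, a ≤ k → k < b → cellPos n k ≠ p ∧ cellPos n k + 1 ≠ p) :
    T.label b p = T.label a p := by
  rw [label, label, route, route, routing_apply_of_ne hab h]

/-- The number of cells read before the cell in row `i` and column `j`. -/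
def cellTime (i j : Fin n) : ℕ := (n - 1 - i) * n + j

/-- The label of the west edge of a cell. -/
def westLabel (i j : Fin n) : ℕ∞ := T.label (cellTime i j) (i + j)

/-- The label of the south edge of a cell. -/
def southLabel (i j : Fin n) : ℕ∞ := T.label (cellTime i j) (i + j + 1)

/-- The label of the north edge of a cell. -/
def northLabel (i j : Fin n) : ℕ∞ := T.label (cellTime i j + 1) (i + j)

/-- The label of the east edge of a cell. -/
def eastLabel (i j : Fin n) : ℕ∞ := T.label (cellTime i j + 1) (i + j + 1)

theorem cellTime_lt (i j : Fin n) : cellTime i j < n * n := by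
  have : (n - 1 - i : ℕ) + 1 ≤ n := by omega
  have h := Nat.mul_le_mul_right n this
  have := j.2
  rw [cellTime]
  nlinarith

theorem cellPos_cellTime (i j : Fin n) : cellPos n (cellTime i j) = i + j := by
  rw [cellTime, cellPos_mul_add j.2]
  omega

theorem tileSeq_cellTime (i j : Fin n) : T.tileSeq (cellTime i j) = T i j := by
  rw [cellTime, tileSeq_mul_add _ (by omega) j.2]
  congr 1
  congr 1
  omega

theorem exists_cellTime {k : ℕ} (hk : k < n * n) : ∃ i j : Fin n, k = cellTime i j := by
  obtain ⟨r, j, hr, hj, rfl⟩ := exists_eq_mul_add hk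
  refine ⟨⟨n - 1 - r, by omega⟩, ⟨j, hj⟩, ?_⟩
  rw [cellTime]
  congr 2
  dsimp only
  omega

theorem cellTime_injective {i j i' j' : Fin n} (h : cellTime i j = cellTime i' j') :
    i = i' ∧ j = j' := by
  have h1 := congrArg (· / n) h
  have h2 := congrArg (· % n) h
  simp only [cellTime, mul_add_div_of_lt, Nat.mul_add_mod_of_lt, Fin.is_lt] at h1 h2
  omega

theorem northLabel_eq (i j : Fin n) :
    T.northLabel i j = if (T i j).passes then T.southLabel i j else T.westLabel i j := by
  rw [northLabel, label, route, routing, tileSeq_cellTime, cellPos_cellTime]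
  split_ifs
  · rw [Equiv.Perm.mul_apply, Equiv.swap_apply_left]; rfl
  · rfl

theorem eastLabel_eq (i j : Fin n) :
    T.eastLabel i j = if (T i j).passes then T.westLabel i j else T.southLabel i j := by
  rw [eastLabel, label, route, routing, tileSeq_cellTime, cellPos_cellTime]
  split_ifs
  · rw [Equiv.Perm.mul_apply, Equiv.swap_apply_right]; rfl
  · rfl

theorem label_zero (p : ℕ) : T.label 0 p = startWord n p := rfl

theorem lt_of_mul_add_lt {n r j r' : ℕ} (h : r * n + j < r' * n) : r < r' :=
  lt_of_mul_lt_mul_right (by omega : r * n < r' * n) (Nat.zero_le n)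

theorem westLabel_first {i j : Fin n} (hj : (j : ℕ) = 0) : T.westLabel i j = ⊤ := by
  rw [westLabel, label_eq_of_ne T (Nat.zero_le _), label_zero, startWord, if_pos (by omega)]
  intro k _ hk
  obtain ⟨r, j', hr, hj', rfl⟩ := exists_eq_mul_add (hk.trans (cellTime_lt i j))
  rw [cellTime, hj, add_zero] at hk
  have := lt_of_mul_add_lt hk
  rw [cellPos_mul_add hj']
  omega

theorem westLabel_succ {i j j' : Fin n} (hj : (j : ℕ) + 1 = j') :
    T.westLabel i j' = T.eastLabel i j := by
  rw [westLabel, eastLabel, cellTime, cellTime, ← hj, ← add_assoc, ← add_assoc]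

theorem southLabel_last {i j : Fin n} (hi : (i : ℕ) + 1 = n) :
    T.southLabel i j = ((j : ℕ) : ℕ∞) := by
  rw [southLabel, label_eq_of_ne T (Nat.zero_le _), label_zero, startWord_eq_coe]
  · omega
  intro k _ hk
  rw [cellTime, show n - 1 - (i : ℕ) = 0 by omega, zero_mul, zero_add] at hk
  have : cellPos n (0 * n + k) = _ := cellPos_mul_add (by omega)
  rw [zero_mul, zero_add] at this
  omega

/-- Between the two readings, the rest of row `i'` touches only letters to the right of the shared
edge, and the beginning of row `i` only letters to its left. -/
theorem southLabel_succ {i i' j : Fin n} (hi : (i : ℕ) + 1 = i') :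
    T.southLabel i j = T.northLabel i' j := by
  have h1 : n - 1 - (i : ℕ) = n - 1 - i' + 1 := by omega
  rw [southLabel, northLabel, cellTime, cellTime, h1, Nat.succ_mul]
  have hp : (i : ℕ) + j + 1 = i' + j := by omega
  rw [hp]
  refine label_eq_of_ne T (by omega) fun k hk hk' => ?_
  rcases Nat.lt_or_ge k ((n - 1 - i') * n + n) with h | h
  · obtain ⟨m, rfl⟩ := Nat.exists_eq_add_of_le (by omega : (n - 1 - i' : ℕ) * n ≤ k)
    rw [cellPos_mul_add (by omega)]
    omega
  · obtain ⟨m, rfl⟩ := Nat.exists_eq_add_of_le h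
    rw [← Nat.succ_mul, cellPos_mul_add (by omega)]
    omega

theorem label_last_north {i j : Fin n} (hi : (i : ℕ) = 0) :
    T.label (n * n) j = T.northLabel i j := by
  rw [northLabel, hi, zero_add]
  refine label_eq_of_ne T (cellTime_lt i j) fun k hk hk' => ?_
  obtain ⟨r, j', hr, hj', rfl⟩ := exists_eq_mul_add hk'
  rw [cellTime, hi] at hk
  have h1 : n - 1 - 0 ≤ r := by
    by_contra h
    have := Nat.mul_le_mul_right n (by omega : r + 1 ≤ n - 1 - 0)
    rw [Nat.succ_mul] at this
    omega
  obtain rfl : r = n - 1 - 0 := by omega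
  rw [cellPos_mul_add hj']
  omega

theorem label_last_east {i j : Fin n} (hj : (j : ℕ) + 1 = n) :
    T.label (n * n) (n + i) = T.eastLabel i j := by
  rw [eastLabel, show (i : ℕ) + j + 1 = n + i by omega]
  refine label_eq_of_ne T (cellTime_lt i j) fun k hk hk' => ?_
  obtain ⟨r, j', hr, hj', rfl⟩ := exists_eq_mul_add hk'
  rw [cellTime, add_assoc, hj, ← Nat.succ_mul, Nat.succ_eq_add_one] at hk
  have h1 : n - 1 - i + 1 ≤ r := by
    by_contra h
    have := Nat.mul_le_mul_right n (by omega : r + 1 ≤ n - 1 - i + 1)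
    rw [Nat.succ_mul] at this
    omega
  rw [cellPos_mul_add hj']
  omega

theorem cellPos_add_one_lt {k : ℕ} (hk : k < n * n) : cellPos n k + 1 < 2 * n := by
  obtain ⟨r, j', hr, hj', rfl⟩ := exists_eq_mul_add hk
  rw [cellPos_mul_add hj']
  omega

theorem route_apply_of_ge {k p : ℕ} (hk : k ≤ n * n) (hp : 2 * n ≤ p) : T.route k p = p := by
  rw [route, routing_apply_of_ne (Nat.zero_le k)]
  · rfl
  · intro l _ hl
    have := cellPos_add_one_lt (hl.trans_le hk)
    omega

/-- The labels of the frontier word are labels of pipes. -/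
theorem exists_label_eq {k p : ℕ} (hk : k ≤ n * n) (hp : p < 2 * n) (h : T.label k p ≠ ⊤) :
    ∃ q : Fin n, T.label k p = ((q : ℕ) : ℕ∞) := by
  have h1 : T.route k p < 2 * n := by
    by_contra hlt
    have h2 := (T.route k).injective (T.route_apply_of_ge hk (not_lt.1 hlt))
    omega
  rw [label, startWord] at h ⊢
  split_ifs at h ⊢ with h3
  · exact absurd rfl h
  · exact ⟨⟨_, by omega⟩, rfl⟩

theorem label_eq_coe {k p q : ℕ} : T.label k p = q ↔ T.route k p = n + q := startWord_eq_coe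

end BPDTiling

/-! ### Bumpless pipe dreams as sequences of fitting tiles -/

theorem BPDTile.Carries.outgoing {t : BPDTile} {w s : ℕ∞} (h : t.Carries w s) :
    (t.north = true ↔ (if t.passes then s else w) ≠ ⊤) ∧
      (t.east = true ↔ (if t.passes then w else s) ≠ ⊤) := by
  cases t <;> simp_all [Carries, north, east, west, south, passes]

namespace BPDTiling

variable {n : ℕ} {T : BPDTiling n}

/-- The tiles fit to the labels of their edges. -/
def CarriesLabels (T : BPDTiling n) : Prop :=
  ∀ i j, (T i j).Carries (T.westLabel i j) (T.southLabel i j)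

theorem CarriesLabels.north_iff (h : T.CarriesLabels) (i j : Fin n) :
    (T i j).north = true ↔ T.northLabel i j ≠ ⊤ := by
  rw [northLabel_eq]; exact (h i j).outgoing.1

theorem CarriesLabels.east_iff (h : T.CarriesLabels) (i j : Fin n) :
    (T i j).east = true ↔ T.eastLabel i j ≠ ⊤ := by
  rw [eastLabel_eq]; exact (h i j).outgoing.2

/-- The matching conditions propagate occupancy of edges upwards through the rows and to the right
within a row, just as labels are propagated. -/
theorem IsPipeTiling.carriesLabels (h : T.IsPipeTiling) : T.CarriesLabels := by
  have key : ∀ r : ℕ, ∀ i : Fin n, (i : ℕ) + r + 1 = n → ∀ m : ℕ, ∀ j : Fin n, (j : ℕ) = m →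
      (T i j).Carries (T.westLabel i j) (T.southLabel i j) := by
    intro r
    induction r with
    | zero =>
      intro i hi m
      induction m with
      | zero =>
        intro j hj
        simp [BPDTile.Carries, westLabel_first T hj, southLabel_last T hi, h.west_side i j hj,
          h.south_side i j hi]
      | succ m ihm =>
        intro j hj
        have h1 := (ihm ⟨m, by omega⟩ rfl).outgoing.2
        rw [← eastLabel_eq, h.match_horizontal i ⟨m, by omega⟩ j hj.symm,
          ← westLabel_succ T hj.symm] at h1
        exact ⟨h1, by simp [southLabel_last T hi, h.south_side i j hi]⟩
    | succ r ihr =>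
      intro i hi m
      have h2 (j : Fin n) : (T i j).south = true ↔ T.southLabel i j ≠ ⊤ := by
        have hi' : (i : ℕ) + 1 = (⟨i + 1, by omega⟩ : Fin n) := rfl
        have := (ihr ⟨i + 1, by omega⟩ (by dsimp only; omega) j j rfl).outgoing.1
        rwa [← northLabel_eq, ← h.match_vertical i _ j hi', ← southLabel_succ T hi'] at this
      induction m with
      | zero =>
        intro j hj
        exact ⟨by simp [westLabel_first T hj, h.west_side i j hj], h2 j⟩
      | succ m ihm =>
        intro j hj
        have h1 := (ihm ⟨m, by omega⟩ rfl).outgoing.2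
        rw [← eastLabel_eq, h.match_horizontal i ⟨m, by omega⟩ j hj.symm,
          ← westLabel_succ T hj.symm] at h1
        exact ⟨h1, h2 j⟩
  intro i j
  exact key (n - 1 - i) i (by omega) j j rfl

theorem CarriesLabels.isPipeTiling (h : T.CarriesLabels)
    (hnorth : ∀ i j : Fin n, (i : ℕ) = 0 → T.northLabel i j = ⊤)
    (heast : ∀ i j : Fin n, (j : ℕ) + 1 = n → T.eastLabel i j ≠ ⊤) : T.IsPipeTiling where
  match_horizontal i j j' hj := by
    rw [Bool.eq_iff_iff, h.east_iff, (h i j').1, westLabel_succ T hj]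
  match_vertical i i' j hi := by
    rw [Bool.eq_iff_iff, h.north_iff, (h i j).2, southLabel_succ T hi]
  south_side i j hi := by
    rw [(h i j).2, southLabel_last T hi]
    simp
  east_side i j hj := (h.east_iff i j).2 (heast i j hj)
  north_side i j hi := by
    rw [← Bool.not_eq_true, h.north_iff, not_not]
    exact hnorth i j hi
  west_side i j hj := by
    rw [← Bool.not_eq_true, (h i j).1, not_not]
    exact westLabel_first T hj

/-! ### Pipes and crossings in terms of edge labels -/

theorem Enters.label_eq {p i j : Fin n} {e : Entry} (h : T.Enters p i j e) :
    match e with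
    | .fromSouth => T.southLabel i j = ((p : ℕ) : ℕ∞)
    | .fromWest => T.westLabel i j = ((p : ℕ) : ℕ∞) := by
  induction h with
  | start i hi => exact southLabel_last T hi
  | up i i' j hi h ht ih =>
    dsimp only at ih ⊢
    rw [southLabel_succ T hi, northLabel_eq, ← ih]
    rcases ht with ht | ht <;> simp [ht, BPDTile.passes]
  | turnRight i j j' hj h ht ih =>
    dsimp only at ih ⊢
    rw [westLabel_succ T hj, eastLabel_eq, ← ih]
    simp [ht, BPDTile.passes]
  | right i j j' hj h ht ih =>
    dsimp only at ih ⊢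
    rw [westLabel_succ T hj, eastLabel_eq, ← ih]
    rcases ht with ht | ht <;> simp [ht, BPDTile.passes]
  | turnUp i i' j hi h ht ih =>
    dsimp only at ih ⊢
    rw [southLabel_succ T hi, northLabel_eq, ← ih]
    simp [ht, BPDTile.passes]

/-- A label is traced back to the neighbouring cell it came from; since the tile there fits its
labels, only the tiles of one constructor of `Enters` remain. -/
theorem CarriesLabels.enters_aux (h : T.CarriesLabels) (p : Fin n) (r : ℕ) :
    ∀ i : Fin n, (i : ℕ) + r + 1 = n → ∀ j : Fin n,
      (T.southLabel i j = ((p : ℕ) : ℕ∞) → T.Enters p i j .fromSouth) ∧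
        (T.westLabel i j = ((p : ℕ) : ℕ∞) → T.Enters p i j .fromWest) := by
  have hwest (i : Fin n)
      (hs : ∀ j, T.southLabel i j = ((p : ℕ) : ℕ∞) → T.Enters p i j .fromSouth) :
      ∀ m : ℕ, ∀ j : Fin n, (j : ℕ) = m → T.westLabel i j = ((p : ℕ) : ℕ∞) →
        T.Enters p i j .fromWest := by
    intro m
    induction m with
    | zero =>
      intro j hj hw
      rw [westLabel_first T hj] at hw
      simp at hw
    | succ m ihm =>
      intro j hj hw
      set j' : Fin n := ⟨m, by omega⟩
      have hj' : (j' : ℕ) + 1 = j := hj.symm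
      rw [westLabel_succ T hj', eastLabel_eq] at hw
      have hc := h i j'
      split_ifs at hw with hp
      · refine Enters.right i j' j hj' (ihm j' rfl hw) ?_
        rw [hw] at hc
        revert hc hp
        cases T i j' <;> simp [BPDTile.Carries, BPDTile.west, BPDTile.passes]
      · refine Enters.turnRight i j' j hj' (hs j' hw) ?_
        rw [hw] at hc
        revert hc hp
        cases T i j' <;> simp [BPDTile.Carries, BPDTile.south, BPDTile.passes]
  induction r with
  | zero =>
    intro i hi
    have hs (j : Fin n) (hj : T.southLabel i j = ((p : ℕ) : ℕ∞)) : T.Enters p i j .fromSouth := by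
      rw [southLabel_last T hi, Nat.cast_inj, ← Fin.ext_iff] at hj
      rw [hj]
      exact Enters.start i hi
    exact fun j => ⟨hs j, hwest i hs j j rfl⟩
  | succ r ihr =>
    intro i hi
    have hs (j : Fin n) (hj : T.southLabel i j = ((p : ℕ) : ℕ∞)) : T.Enters p i j .fromSouth := by
      set i' : Fin n := ⟨i + 1, by omega⟩
      have hi' : (i : ℕ) + 1 = i' := rfl
      obtain ⟨h1, h2⟩ := ihr i' (by omega) j
      rw [southLabel_succ T hi', northLabel_eq] at hj
      have hc := h i' j
      split_ifs at hj with hp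
      · refine Enters.up i' i j hi' (h1 hj) ?_
        rw [hj] at hc
        revert hc hp
        cases T i' j <;> simp [BPDTile.Carries, BPDTile.south, BPDTile.passes]
      · refine Enters.turnUp i' i j hi' (h2 hj) ?_
        rw [hj] at hc
        revert hc hp
        cases T i' j <;> simp [BPDTile.Carries, BPDTile.west, BPDTile.passes]
    exact fun j => ⟨hs j, hwest i hs j j rfl⟩

theorem CarriesLabels.enters_fromSouth_iff (h : T.CarriesLabels) {p i j : Fin n} :
    T.Enters p i j .fromSouth ↔ T.southLabel i j = ((p : ℕ) : ℕ∞) :=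
  ⟨fun h' => h'.label_eq, (h.enters_aux p (n - 1 - i) i (by omega) j).1⟩

theorem CarriesLabels.enters_fromWest_iff (h : T.CarriesLabels) {p i j : Fin n} :
    T.Enters p i j .fromWest ↔ T.westLabel i j = ((p : ℕ) : ℕ∞) :=
  ⟨fun h' => h'.label_eq, (h.enters_aux p (n - 1 - i) i (by omega) j).2⟩

theorem CarriesLabels.exitsAt_iff (h : T.CarriesLabels) {p i j : Fin n} (hj : (j : ℕ) + 1 = n) :
    T.ExitsAt p i ↔ T.eastLabel i j = ((p : ℕ) : ℕ∞) := by
  have : T.ExitsAt p i ↔ (T.Enters p i j .fromSouth ∧ T i j = .r) ∨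
      (T.Enters p i j .fromWest ∧ (T i j = .horiz ∨ T i j = .cross)) := by
    refine ⟨?_, fun h' => ⟨j, hj, h'⟩⟩
    rintro ⟨j', hj', h'⟩
    obtain rfl : j' = j := Fin.ext (by omega)
    exact h'
  rw [this, h.enters_fromSouth_iff, h.enters_fromWest_iff, eastLabel_eq]
  have hc := h i j
  revert hc
  cases T i j <;> simp [BPDTile.Carries, BPDTile.passes, BPDTile.west, BPDTile.south] <;> simp_all

theorem CarriesLabels.crossAt_iff (h : T.CarriesLabels) {p q i j : Fin n} :
    T.CrossAt p q i j ↔ T i j = .cross ∧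
      ((T.southLabel i j = ((p : ℕ) : ℕ∞) ∧ T.westLabel i j = ((q : ℕ) : ℕ∞)) ∨
        (T.southLabel i j = ((q : ℕ) : ℕ∞) ∧ T.westLabel i j = ((p : ℕ) : ℕ∞))) := by
  rw [CrossAt, h.enters_fromSouth_iff, h.enters_fromWest_iff, h.enters_fromSouth_iff,
    h.enters_fromWest_iff]

theorem westLabel_eq_coe {i j : Fin n} {p : ℕ} : T.westLabel i j = p ↔
    routing (cellPos n) T.tileSeq (cellTime i j) (cellPos n (cellTime i j)) = n + p := by
  rw [westLabel, label_eq_coe, cellPos_cellTime, route]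

theorem southLabel_eq_coe {i j : Fin n} {p : ℕ} : T.southLabel i j = p ↔
    routing (cellPos n) T.tileSeq (cellTime i j) (cellPos n (cellTime i j) + 1) = n + p := by
  rw [southLabel, label_eq_coe, cellPos_cellTime, route]

/-- If the order of two pipes is reversed between two times, then they cross in between. -/
theorem CarriesLabels.exists_cross (h : T.CarriesLabels) {a b p q : ℕ} (hab : a ≤ b)
    (hb : b ≤ n * n) (ha : (T.route a).symm (n + p) < (T.route a).symm (n + q))
    (hb' : (T.route b).symm (n + q) < (T.route b).symm (n + p)) :
    ∃ i j, a ≤ cellTime i j ∧ cellTime i j < b ∧ T i j = .cross ∧ T.westLabel i j = p ∧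
      T.southLabel i j = q := by
  obtain ⟨k, h1, h2, h3, h4, h5⟩ := exists_swap_of_reversed hab ha hb'
  obtain ⟨i, j, rfl⟩ := exists_cellTime (h2.trans_le hb)
  rw [← westLabel_eq_coe] at h4
  rw [← southLabel_eq_coe] at h5
  refine ⟨i, j, h1, h2, ?_, h4, h5⟩
  have hc := h i j
  rw [tileSeq_cellTime] at h3
  rw [h4, h5] at hc
  revert hc h3
  cases T i j <;> simp [BPDTile.Carries, BPDTile.south, BPDTile.west, BPDTile.passes]

theorem CarriesLabels.symm_lt_of_cross {i j : Fin n} {p q : ℕ}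
    (hc : T i j = .cross) (hp : T.westLabel i j = p) (hq : T.southLabel i j = q) :
    (T.route (cellTime i j)).symm (n + p) < (T.route (cellTime i j)).symm (n + q) ∧
      (T.route (cellTime i j + 1)).symm (n + q) < (T.route (cellTime i j + 1)).symm (n + p) := by
  rw [westLabel_eq_coe] at hp
  rw [southLabel_eq_coe] at hq
  refine ⟨?_, reversed_of_swap (by rw [tileSeq_cellTime, hc]; rfl) hp hq⟩
  rw [← hp, ← hq]
  simp [route]

/-- A tiling by pipes is reduced if and only if in every crossing the pipe with the smaller label
comes from the west. -/
theorem CarriesLabels.reduced_iff (h : T.CarriesLabels) :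
    (∀ p q : Fin n, p ≠ q → ∀ i j i' j' : Fin n,
      T.CrossAt p q i j → T.CrossAt p q i' j' → i = i' ∧ j = j') ↔
    ∀ i j, T i j = .cross → T.westLabel i j < T.southLabel i j := by
  constructor
  · intro hred i j hc
    have hcar := h i j
    rw [hc] at hcar
    simp only [BPDTile.Carries, BPDTile.west, BPDTile.south, true_iff] at hcar
    obtain ⟨p, hp⟩ := T.exists_label_eq (cellTime_lt i j).le (by omega) hcar.1
    obtain ⟨q, hq⟩ := T.exists_label_eq (cellTime_lt i j).le (by omega) hcar.2
    change T.westLabel i j = _ at hp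
    change T.southLabel i j = _ at hq
    by_contra hlt
    have h1 := (CarriesLabels.symm_lt_of_cross hc hp hq).1
    rw [hp, hq, Nat.cast_lt, not_lt] at hlt
    have hne : (q : ℕ) ≠ p := by
      intro he
      rw [he] at h1
      omega
    -- At time 0 the smaller label `q` is to the left of `p`, now it is to the right: the pipes have
    -- already crossed, so this is their second crossing.
    have h0 : (T.route 0).symm (n + q) < (T.route 0).symm (n + p) := by
      change (1 : Equiv.Perm ℕ).symm _ < (1 : Equiv.Perm ℕ).symm _
      simp only [← Equiv.Perm.inv_def, inv_one, Equiv.Perm.one_apply]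
      omega
    obtain ⟨i', j', _, hlt', hc', hq', hp'⟩ :=
      h.exists_cross (Nat.zero_le _) (cellTime_lt i j).le h0 h1
    obtain ⟨rfl, rfl⟩ := hred q p (fun he => hne (by rw [he])) i j i' j'
      (h.crossAt_iff.2 ⟨hc, .inl ⟨hq, hp⟩⟩) (h.crossAt_iff.2 ⟨hc', .inr ⟨hp', hq'⟩⟩)
    omega
  · intro hlt
    have key (p q : Fin n) (hpq : p < q) (i j : Fin n) (hx : T.CrossAt p q i j) :
        T i j = .cross ∧ T.westLabel i j = ((p : ℕ) : ℕ∞) ∧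
          T.southLabel i j = ((q : ℕ) : ℕ∞) := by
      obtain ⟨hc, ⟨h1, h2⟩ | ⟨h1, h2⟩⟩ := h.crossAt_iff.1 hx
      · have := hlt i j hc
        rw [h1, h2, Nat.cast_lt] at this
        omega
      · exact ⟨hc, h2, h1⟩
    have key2 (p q : Fin n) (hpq : p < q) (i j i' j' : Fin n) (hx : T.CrossAt p q i j)
        (hx' : T.CrossAt p q i' j') : ¬ cellTime i j < cellTime i' j' := by
      intro htime
      obtain ⟨hc, hp, hq⟩ := key p q hpq i j hx
      obtain ⟨hc', hp', hq'⟩ := key p q hpq i' j' hx'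
      -- After the first crossing `q` is left of `p`, just before the second one `p` is left of `q`.
      -- In between they must cross with `q` coming from the west, against `hlt`.
      obtain ⟨k, l, _, _, hc'', hq'', hp''⟩ := h.exists_cross (Nat.succ_le_of_lt htime)
        (cellTime_lt i' j').le (CarriesLabels.symm_lt_of_cross hc hp hq).2
        (CarriesLabels.symm_lt_of_cross hc' hp' hq').1
      have := hlt k l hc''
      rw [hp'', hq'', Nat.cast_lt] at this
      omega
    have key3 (p q : Fin n) (hpq : p < q) (i j i' j' : Fin n) (hx : T.CrossAt p q i j)
        (hx' : T.CrossAt p q i' j') : i = i' ∧ j = j' :=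
      cellTime_injective (le_antisymm (not_lt.1 (key2 p q hpq i' j' i j hx' hx))
        (not_lt.1 (key2 p q hpq i j i' j' hx hx')))
    intro p q hpq i j i' j' hx hx'
    rcases lt_or_gt_of_ne hpq with hlt | hlt
    · exact key3 p q hlt i j i' j' hx hx'
    · exact key3 q p hlt i j i' j' ⟨hx.1, hx.2.symm⟩ ⟨hx'.1, hx'.2.symm⟩

theorem fitsAll_iff {P : BPDTile → ℕ∞ → ℕ∞ → Prop} :
    FitsAll P (cellPos n) T.tileSeq (startWord n) (n * n) ↔
      ∀ i j, P (T i j) (T.westLabel i j) (T.southLabel i j) := by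
  have key (i j : Fin n) : P (T i j) (T.westLabel i j) (T.southLabel i j) ↔
      P (T.tileSeq (cellTime i j))
        (startWord n (routing (cellPos n) T.tileSeq (cellTime i j) (cellPos n (cellTime i j))))
        (startWord n
          (routing (cellPos n) T.tileSeq (cellTime i j) (cellPos n (cellTime i j) + 1))) := by
    rw [tileSeq_cellTime, cellPos_cellTime]
    rfl
  refine ⟨fun h i j => (key i j).2 (h _ (cellTime_lt i j)), fun h k hk => ?_⟩
  obtain ⟨i, j, rfl⟩ := exists_cellTime hk
  exact (key i j).1 (h i j)

theorem label_last_eq_endWord_iff {π : Equiv.Perm (Fin n)} :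
    T.label (n * n) = endWord π ↔ (∀ i j : Fin n, (i : ℕ) = 0 → T.northLabel i j = ⊤) ∧
      ∀ i j : Fin n, (j : ℕ) + 1 = n → T.eastLabel i j = ((π i : ℕ) : ℕ∞) := by
  constructor
  · intro h
    refine ⟨fun i j hi => ?_, fun i j hj => ?_⟩
    · rw [← label_last_north T hi, h, endWord, if_pos j.2]
    · rw [← label_last_east T hj, h, endWord, if_neg (by omega), dif_pos (by omega)]
      simp
  · rintro ⟨h1, h2⟩
    funext k
    rw [endWord]
    split_ifs with hk hk'
    · exact (label_last_north T (i := ⟨0, by omega⟩) (j := ⟨k, hk⟩) rfl).trans (h1 _ _ rfl)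
    · have h3 := label_last_east T (i := ⟨k - n, hk'⟩) (j := ⟨n - 1, by omega⟩)
        (by dsimp only; omega)
      rw [h2 _ _ (by dsimp only; omega)] at h3
      rw [← h3]
      congr 1
      dsimp only
      omega
    · rw [label, route_apply_of_ge T le_rfl (by omega), startWord, if_neg hk]

/-- Reducedness is absorbed into `Fits` by `reduced_iff`; the empty north side and the exits on the
east side are the letters of the final word. -/
theorem mem_BPD_iff {π : Equiv.Perm (Fin n)} :
    T ∈ BPD π ↔ FitsAll BPDTile.Fits (cellPos n) T.tileSeq (startWord n) (n * n) ∧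
      startWord n ∘ T.route (n * n) = endWord π := by
  change _ ↔ _ ∧ T.label (n * n) = endWord π
  rw [fitsAll_iff, label_last_eq_endWord_iff]
  constructor
  · rintro ⟨h, hexit⟩
    have hc := h.toIsPipeTiling.carriesLabels
    refine ⟨fun i j => ⟨hc i j, hc.reduced_iff.1 h.reduced i j⟩, fun i j hi => ?_,
      fun i j hj => (hc.exitsAt_iff hj).1 (hexit i)⟩
    have := h.north_side i j hi
    rwa [← Bool.not_eq_true, hc.north_iff, not_not] at this
  · rintro ⟨hfit, hnorth, heast⟩
    have hc : T.CarriesLabels := fun i j => (hfit i j).1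
    refine ⟨⟨hc.isPipeTiling hnorth fun i j hj => by simp [heast i j hj],
      hc.reduced_iff.2 fun i j => (hfit i j).2⟩, fun i => ?_⟩
    have hi := i.2
    have hj : ((⟨n - 1, by omega⟩ : Fin n) : ℕ) + 1 = n := by dsimp only; omega
    exact (hc.exitsAt_iff hj).2 (heast i _ hj)

end BPDTiling

/-! ### The generating function of bumpless pipe dreams -/

section GeneratingFunction

variable {R : Type*} [CommRing R] {n : ℕ}

open Classical in
/-- The generating function of the bumpless pipe dreams of `π`, evaluated in a commutative ring. -/
noncomputable def bpdSum (π : Equiv.Perm (Fin n)) (x : Fin n → R) : R :=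
  ∑ D ∈ Finset.univ.filter (fun D : BPDTiling n => D ∈ BPD π), ∏ c ∈ D.blank, x c.1

theorem prod_blank_eq (T : BPDTiling n) (x : ℕ → R) :
    ∏ c ∈ T.blank, x c.1 = ∏ k : Fin (n * n),
      if tilingEquiv n T k = .blank then x (n - 1 - k / n) else 1 := by
  rw [BPDTiling.blank, Finset.prod_filter,
    ← (finProdFinEquiv.symm.trans (Fin.revPerm.prodCongr (Equiv.refl (Fin n)))).prod_comp]
  refine Finset.prod_congr rfl fun k _ => ?_
  change (if tilingEquiv n T k = .blank then x (Fin.rev k.divNat : Fin n) else 1) = _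
  rw [Fin.val_rev, Nat.sub_add_eq, Nat.sub_right_comm]
  rfl

open Classical in
theorem bpdSum_eq_rowsOp (π : Equiv.Perm (Fin n)) (x : ℕ → R) :
    bpdSum π (fun i => x i) =
      rowsOp n x n (fun F => if F = endWord π then 1 else 0) (startWord n) := by
  rw [rowsOp_eq_cellsOp]
  change _ = cellsOp (cellPos n) _ _ _ _
  rw [cellsOp_eq_sum, ← (tilingEquiv n).sum_comp, bpdSum, Finset.sum_filter]
  refine Finset.sum_congr rfl fun T _ => ?_
  rw [BPDTiling.mem_BPD_iff, prod_blank_eq T x, mul_ite, mul_one, mul_zero, ← ite_and]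
  convert rfl <;> rfl

theorem cellsOp_add_smul (pos : ℕ → ℕ) (x : ℕ → R) (m : ℕ) (φ ψ : (ℕ → ℕ∞) → R) (c : R) :
    cellsOp pos x m (fun F => φ F + c * ψ F) =
      fun F => cellsOp pos x m φ F + c * cellsOp pos x m ψ F := by
  induction m generalizing φ ψ with
  | zero => rfl
  | succ m ih =>
    simp only [cellsOp]
    rw [← ih]
    congr 1
    funext F
    simp only [cellOp, localOp]
    ring

theorem rowsOp_add_smul (x : ℕ → R) (r : ℕ) (φ ψ : (ℕ → ℕ∞) → R) (c : R) :
    rowsOp n x r (fun F => φ F + c * ψ F) =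
      fun F => rowsOp n x r φ F + c * rowsOp n x r ψ F := by
  rw [rowsOp_eq_cellsOp, cellsOp_add_smul, rowsOp_eq_cellsOp, rowsOp_eq_cellsOp]

theorem endWord_of_add (π : Equiv.Perm (Fin n)) (i : Fin n) :
    endWord π (i + n) = ((π i : ℕ) : ℕ∞) := by
  rw [endWord, if_neg (by omega), dif_pos (by omega)]
  simp

theorem swapWord_endWord (π : Equiv.Perm (Fin n)) {i i' : Fin n} (hi : (i : ℕ) + 1 = i') :
    swapWord (i + n) (endWord π) = endWord (π * Equiv.swap i i') := by
  have h1 : (i : ℕ) + n + 1 = i' + n := by omega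
  funext k
  by_cases hk : k = i + n
  · rw [hk, swapWord_left, h1, endWord_of_add, endWord_of_add]
    simp
  by_cases hk' : k = i + n + 1
  · rw [hk', swapWord_right, h1, endWord_of_add, endWord_of_add]
    simp
  rw [swapWord_of_ne _ hk hk', endWord, endWord]
  split_ifs with h0 h
  · rfl
  · rw [Equiv.Perm.mul_apply, Equiv.swap_apply_of_ne_of_ne] <;> rw [Ne, Fin.ext_iff] <;>
      dsimp only <;> omega
  · rfl

-- The exchange term lives on the word of `π * Equiv.swap i i'`, and that word is increasing at the
-- two letters exactly when `π` descends at `i`.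
open Classical in
theorem braidOp_endWord (π : Equiv.Perm (Fin n)) {i i' : Fin n} (hi : (i : ℕ) + 1 = i') (z : R) :
    braidOp (i + n) z (fun F => if F = endWord π then 1 else 0) = fun F =>
      (if F = endWord π then 1 else 0) + (if π i' < π i then z else 0) *
        (if F = endWord (π * Equiv.swap i i') then 1 else 0) := by
  have h1 : (i : ℕ) + n + 1 = i' + n := by omega
  funext F
  have h2 : swapWord (i + n) F = endWord π ↔ F = endWord (π * Equiv.swap i i') := by
    rw [← swapWord_endWord π hi]
    exact ⟨fun h => by rw [← h, swapWord_swapWord], fun h => by rw [h, swapWord_swapWord]⟩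
  simp only [braidOp, localOp, h2, one_mul]
  congr 1
  by_cases h3 : F = endWord (π * Equiv.swap i i')
  · rw [h3, h1, endWord_of_add, endWord_of_add]
    simp
  · simp [h3]

/-- Exchanging two neighbouring variables. -/
theorem bpdSum_swap (π : Equiv.Perm (Fin n)) (x : Fin n → R) {i i' : Fin n}
    (hi : (i : ℕ) + 1 = i') :
    bpdSum π x = bpdSum π (x ∘ Equiv.swap i i') + (if π i' < π i then x i - x i' else 0) *
      bpdSum (π * Equiv.swap i i') (x ∘ Equiv.swap i i') := by
  classical
  set y : ℕ → R := fun k => if h : k < n then x ⟨k, h⟩ else 0 with hy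
  have hx : x = fun j : Fin n => y j := by
    funext j
    simp [hy]
  have hx' : x ∘ Equiv.swap i i' = fun j : Fin n => (y ∘ Equiv.swap (i : ℕ) (i + 1)) j := by
    funext j
    rw [hi, Function.comp, Function.comp, hx]
    dsimp only
    rw [← Function.Injective.map_swap Fin.val_injective]
  rw [hx', hx, bpdSum_eq_rowsOp, bpdSum_eq_rowsOp, bpdSum_eq_rowsOp,
    rowsOp_swap (i := i) (by omega) y (by omega) le_rfl _ (by rw [startWord, if_pos i.2]), hi,
    braidOp_endWord π hi, rowsOp_add_smul]

/-! ### The last variable and the value at the origin -/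

theorem BPDTiling.IsPipeTiling.ne_blank {T : BPDTiling n} (h : T.IsPipeTiling) {i j : Fin n}
    (hi : (i : ℕ) + 1 = n) : T i j ≠ .blank := by
  intro hb
  have := h.south_side i j hi
  rw [hb] at this
  cases this

/-- The last variable does not appear. -/
theorem bpdSum_congr (π : Equiv.Perm (Fin n)) {x y : Fin n → R}
    (h : ∀ i : Fin n, (i : ℕ) + 1 ≠ n → x i = y i) : bpdSum π x = bpdSum π y := by
  classical
  refine Finset.sum_congr rfl fun D hD => Finset.prod_congr rfl fun c hc => h _ fun hi => ?_
  exact (Finset.mem_filter.1 hD).2.1.toIsPipeTiling.ne_blank hi (Finset.mem_filter.1 hc).2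

/-- The only tiling without blank tiles. -/
theorem BPDTiling.IsPipeTiling.eq_of_no_blank {T : BPDTiling n} (h : T.IsPipeTiling)
    (hb : ∀ i j, T i j ≠ .blank) (i j : Fin n) :
    T i j = if j < i then .vert else if j = i then .r else .horiz := by
  have key : ∀ k : ℕ, ∀ i : Fin n, (i : ℕ) = k → ∀ m : ℕ, ∀ j : Fin n, (j : ℕ) = m →
      T i j = if j < i then .vert else if j = i then .r else .horiz := by
    intro k
    induction k with
    | zero =>
      intro i hi m
      have hn (j : Fin n) := h.north_side i j hi
      induction m with
      | zero =>
        intro j hj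
        have h1 := hn j
        have h2 := h.west_side i j hj
        have h3 := hb i j
        have h4 : j = i := Fin.ext (by omega)
        rw [if_neg (by omega), if_pos h4]
        revert h1 h2 h3
        cases T i j <;> simp [BPDTile.north, BPDTile.west]
      | succ m ihm =>
        intro j hj
        have h1 := hn j
        have h2 := h.match_horizontal i ⟨m, by omega⟩ j hj.symm
        have h3 := hb i j
        rw [ihm _ rfl, if_neg (by rw [Fin.lt_def]; dsimp only; omega)] at h2
        rw [if_neg (by omega), if_neg (by omega)]
        revert h1 h2 h3
        split_ifs <;> cases T i j <;> simp [BPDTile.north, BPDTile.west, BPDTile.east]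
    | succ k ihk =>
      intro i hi m
      have hn (j : Fin n) : (T i j).north = true ↔ j < i := by
        rw [← h.match_vertical ⟨k, by omega⟩ i j hi.symm, ihk _ rfl j j rfl]
        simp only [Fin.lt_def, Fin.ext_iff, hi]
        split_ifs <;> simp [BPDTile.south] <;> omega
      induction m with
      | zero =>
        intro j hj
        have h1 := (hn j).2 (by omega)
        have h2 := h.west_side i j hj
        rw [if_pos (by omega)]
        revert h1 h2
        cases T i j <;> simp [BPDTile.north, BPDTile.west]
      | succ m ihm =>
        intro j hj
        have h1 := hn j
        have h2 := h.match_horizontal i ⟨m, by omega⟩ j hj.symm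
        have h3 := hb i j
        rw [ihm _ rfl] at h2
        simp only [Fin.lt_def, Fin.ext_iff] at h1 h2 ⊢
        revert h1 h2 h3
        split_ifs <;> first | omega | cases T i j <;>
          simp [BPDTile.north, BPDTile.west, BPDTile.east] <;> omega
  exact key i i rfl j j rfl

/-- In this tiling pipe `p` climbs column `p` to the diagonal, turns, and follows row `p` to the
east. -/
theorem BPDTiling.IsPipeTiling.exitsAt_eq_of_no_blank {T : BPDTiling n} (h : T.IsPipeTiling)
    (hb : ∀ i j, T i j ≠ .blank) {p i : Fin n} (hp : T.ExitsAt p i) : p = i := by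
  have hT := h.eq_of_no_blank hb
  have key : ∀ (i j : Fin n) (e : Entry), T.Enters p i j e →
      match e with
      | .fromSouth => j = p ∧ p ≤ i
      | .fromWest => i = p ∧ p < j := by
    intro i j e he
    induction he with
    | start i hi => exact ⟨rfl, by omega⟩
    | up i i' j hi he ht ih =>
      dsimp only at ih ⊢
      rw [hT] at ht
      refine ⟨ih.1, ?_⟩
      split_ifs at ht <;> simp at ht
      omega
    | turnRight i j j' hj he ht ih =>
      dsimp only at ih ⊢
      rw [hT] at ht
      split_ifs at ht
      omega
    | right i j j' hj he ht ih =>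
      dsimp only at ih ⊢
      omega
    | turnUp i i' j hi he ht ih =>
      rw [hT] at ht
      split_ifs at ht
  obtain ⟨j, hj, ⟨he, ht⟩ | ⟨he, ht⟩⟩ := hp
  · obtain ⟨h1, h2⟩ := key i j _ he
    rw [hT] at ht
    split_ifs at ht
    omega
  · exact (key i j _ he).1.symm

/-- The generating functions have no constant terms. -/
theorem bpdSum_zero {π : Equiv.Perm (Fin n)} (hπ : π ≠ 1) : bpdSum π (0 : Fin n → R) = 0 := by
  classical
  refine Finset.sum_eq_zero fun D hD => ?_
  obtain ⟨h, hexit⟩ := (Finset.mem_filter.1 hD).2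
  by_contra hprod
  refine hπ (Equiv.ext fun i => h.toIsPipeTiling.exitsAt_eq_of_no_blank (fun i j hb => ?_)
    (hexit i))
  exact hprod (Finset.prod_eq_zero
    (Finset.mem_filter.2 ⟨Finset.mem_univ (i, j), hb⟩) rfl)

end GeneratingFunction

/-! ### Bruhat covers -/

section Bruhat

variable {n : ℕ}

/-- Exchanging the values of `π` at `k < l` is a Bruhat cover. -/
def IsCoverAt (π : Equiv.Perm (Fin n)) (k l : Fin n) : Prop :=
  π k < π l ∧ ∀ m, k < m → m < l → ¬ (π k < π m ∧ π m < π l)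

/-- Transport of pairs of positions along a transposition, as far as it preserves their order. -/
def swapPair (k l : Fin n) (c : Fin n × Fin n) : Fin n × Fin n :=
  if Equiv.swap k l c.1 < Equiv.swap k l c.2 then (Equiv.swap k l c.1, Equiv.swap k l c.2) else c

theorem swapPair_injOn (k l : Fin n) : Set.InjOn (swapPair k l) {c | c.1 < c.2} := by
  have h : ∀ c : Fin n × Fin n, c.1 < c.2 → swapPair k l (swapPair k l c) = c := by
    rintro ⟨a, b⟩ hab
    by_cases h : Equiv.swap k l a < Equiv.swap k l b
    · simp only [swapPair, h, if_true, Equiv.swap_apply_self]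
      exact if_pos hab
    · simp [swapPair, h]
  intro c hc d hd hcd
  rw [← h c hc, hcd, h d hd]

/-- `swapPair` injects the inversions of `π` into those of the product other than `(k, l)`. For a
cover it also works in the opposite direction, see `permLength_le_of_isCoverAt`. -/
theorem permLength_lt {π : Equiv.Perm (Fin n)} {k l : Fin n} (hkl : k < l) (h : π k < π l) :
    permLength π < permLength (π * Equiv.swap k l) := by
  rw [permLength, permLength, ← Nat.add_one_le_iff]
  have hmem : (k, l) ∈ Finset.univ.filter fun c : Fin n × Fin n =>
      c.1 < c.2 ∧ (π * Equiv.swap k l) c.2 < (π * Equiv.swap k l) c.1 := by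
    exact Finset.mem_filter.2 ⟨Finset.mem_univ _, hkl, by simpa using h⟩
  rw [← Finset.card_erase_add_one hmem, add_le_add_iff_right]
  refine Finset.card_le_card_of_injOn (swapPair k l) ?_
    ((swapPair_injOn k l).mono fun c hc => (Finset.mem_filter.1 hc).2.1)
  rintro ⟨a, b⟩ hab
  simp only [Finset.coe_filter, Finset.mem_univ, true_and, Set.mem_ofPred_eq, Finset.coe_erase,
    Set.mem_sdiff, Set.mem_singleton_iff, swapPair, Equiv.Perm.mul_apply,
    Equiv.swap_apply_def] at hab ⊢
  grind

theorem permLength_le_of_isCoverAt {π : Equiv.Perm (Fin n)} {k l : Fin n} (hkl : k < l)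
    (h : IsCoverAt π k l) : permLength (π * Equiv.swap k l) ≤ permLength π + 1 := by
  rw [permLength, permLength]
  have hmem : (k, l) ∈ Finset.univ.filter fun c : Fin n × Fin n =>
      c.1 < c.2 ∧ (π * Equiv.swap k l) c.2 < (π * Equiv.swap k l) c.1 := by
    exact Finset.mem_filter.2 ⟨Finset.mem_univ _, hkl, by simpa using h.1⟩
  rw [← Finset.card_erase_add_one hmem, add_le_add_iff_right]
  refine Finset.card_le_card_of_injOn (swapPair k l) ?_
    ((swapPair_injOn k l).mono fun c hc =>
      (Finset.mem_filter.1 (Finset.mem_of_mem_erase hc)).2.1)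
  rintro ⟨a, b⟩ hab
  obtain ⟨h1, h2⟩ := h
  have hinj (c d : Fin n) : π c = π d → c = d := fun h => π.injective h
  simp only [Finset.coe_filter, Finset.mem_univ, true_and, Set.mem_ofPred_eq, Finset.coe_erase,
    Set.mem_sdiff, Set.mem_singleton_iff, swapPair, Equiv.Perm.mul_apply,
    Equiv.swap_apply_def] at hab ⊢
  grind

theorem BruhatLT.permLength_lt {u v : Equiv.Perm (Fin n)} (h : BruhatLT u v) :
    permLength u < permLength v := by
  induction h with
  | single h => exact h.choose_spec.choose_spec.2.2
  | tail _ h ih => exact ih.trans h.choose_spec.choose_spec.2.2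

theorem bruhatLT_mul_swap {π : Equiv.Perm (Fin n)} {k l : Fin n} (hkl : k < l)
    (h : π k < π l) : BruhatLT π (π * Equiv.swap k l) :=
  .single ⟨k, l, hkl.ne, rfl, permLength_lt hkl h⟩

theorem bruhatCovBy_mul_swap_iff {π : Equiv.Perm (Fin n)} {k l : Fin n} (hkl : k < l) :
    BruhatCovBy π (π * Equiv.swap k l) ↔ IsCoverAt π k l := by
  constructor
  · rintro ⟨hlt, hno⟩
    have h1 : π k < π l := by
      by_contra hle
      have hlt' : π l < π k := lt_of_le_of_ne (not_lt.1 hle) fun h => hkl.ne (π.injective h.symm)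
      have := permLength_lt (π := π * Equiv.swap k l) hkl (by simpa using hlt')
      rw [mul_assoc, Equiv.swap_mul_self, mul_one] at this
      exact lt_asymm this hlt.permLength_lt
    refine ⟨h1, fun m hkm hml hm => hno ⟨π * Equiv.swap k m, bruhatLT_mul_swap hkm hm.1, ?_⟩⟩
    -- An intermediate value at `m` gives a chain of three length-raising transpositions, so `π *
    -- Equiv.swap k m` lies strictly in between.
    have e : π * Equiv.swap k l =
        π * Equiv.swap k m * Equiv.swap k l * Equiv.swap m l := by
      ext a
      simp only [Equiv.Perm.mul_apply, Equiv.swap_apply_def]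
      grind
    rw [e]
    refine .trans (bruhatLT_mul_swap hkl ?_) (bruhatLT_mul_swap hml ?_) <;>
      simp only [Equiv.Perm.mul_apply, Equiv.swap_apply_def] <;> grind
  · intro h
    refine ⟨bruhatLT_mul_swap hkl h.1, ?_⟩
    rintro ⟨w, hw, hw'⟩
    have := permLength_le_of_isCoverAt hkl h
    have := hw.permLength_lt
    have := hw'.permLength_lt
    omega

theorem swap_lt_swap_iff {i i' k l : Fin n} (hi : (i : ℕ) + 1 = i') (hkl : k < l)
    (hne : ¬ (k = i ∧ l = i')) : Equiv.swap i i' k < Equiv.swap i i' l := by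
  simp only [Equiv.swap_apply_def]
  grind

/-- Covers and exchanging two neighbouring positions. -/
theorem isCoverAt_and_descent_iff {π : Equiv.Perm (Fin n)} {i i' k l : Fin n}
    (hi : (i : ℕ) + 1 = i') (hkl : k < l) (hne : ¬ (k = i ∧ l = i')) :
    IsCoverAt π k l ∧ (π * Equiv.swap k l) i' < (π * Equiv.swap k l) i ↔
      π i' < π i ∧ IsCoverAt (π * Equiv.swap i i') (Equiv.swap i i' k) (Equiv.swap i i' l) := by
  have hinj (c d : Fin n) : π c = π d → c = d := fun h => π.injective h
  have h1 : IsCoverAt (π * Equiv.swap i i') (Equiv.swap i i' k) (Equiv.swap i i' l) ↔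
      π k < π l ∧ ∀ m, Equiv.swap i i' k < Equiv.swap i i' m →
        Equiv.swap i i' m < Equiv.swap i i' l → ¬ (π k < π m ∧ π m < π l) := by
    simp only [IsCoverAt, Equiv.Perm.mul_apply, Equiv.swap_apply_self]
    refine and_congr_right fun _ => ⟨fun h m => ?_, fun h m => ?_⟩
    · simpa using h (Equiv.swap i i' m)
    · simpa using h (Equiv.swap i i' m)
  rw [h1, IsCoverAt]
  simp only [Equiv.Perm.mul_apply, Equiv.swap_apply_def]
  constructor
  · rintro ⟨⟨h2, h3⟩, h4⟩
    refine ⟨?_, h2, fun m => ?_⟩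
    -- As `i` and `i'` are neighbours, the exchange can change whether `m` lies between the two
    -- positions only for `m = i` or `m = i'`.
    · have := h3 i
      have := h3 i'
      grind
    · have := h3 m
      grind
  · rintro ⟨h2, h3, h4⟩
    refine ⟨⟨h3, fun m => ?_⟩, ?_⟩
    · have := h4 m
      grind
    · have := h4 i
      have := h4 i'
      grind

end Bruhat

/-! ### Monk's rule -/

section Monk

variable {R : Type*} [CommRing R] {n : ℕ}

open Classical in
/-- The sign of the pair of positions `a`, `l` in Monk's rule, zero if exchanging the values at
these positions is not a cover. -/
noncomputable def monkSign (R : Type*) [CommRing R] (π : Equiv.Perm (Fin n)) (a l : Fin n) : R :=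
  if a < l ∧ IsCoverAt π a l then 1 else if l < a ∧ IsCoverAt π l a then -1 else 0

theorem monkSign_self (π : Equiv.Perm (Fin n)) (a : Fin n) : monkSign R π a a = 0 := by
  simp [monkSign]

/-- The difference of the two sides of Monk's rule. -/
noncomputable def monkDefect (π : Equiv.Perm (Fin n)) (a : Fin n) (x : Fin n → R) : R :=
  x a * bpdSum π x - ∑ l, monkSign R π a l * bpdSum (π * Equiv.swap a l) x

theorem isCoverAt_of_lt {π : Equiv.Perm (Fin n)} {i i' : Fin n} (hi : (i : ℕ) + 1 = i') :
    IsCoverAt π i i' ↔ π i < π i' :=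
  ⟨fun h => h.1, fun h => ⟨h, fun m h1 h2 => by omega⟩⟩

/-- The two terms cancel by `isCoverAt_and_descent_iff` unless `a`, `l` are the exchanged positions.
In that case exactly one of them survives, according to whether `π` ascends or descends at `i`. -/
theorem monkSign_swap (π : Equiv.Perm (Fin n)) {i i' : Fin n} (hi : (i : ℕ) + 1 = i')
    (a l : Fin n) :
    (if (π * Equiv.swap a l) i' < (π * Equiv.swap a l) i then monkSign R π a l else 0) -
      (if π i' < π i then
        monkSign R (π * Equiv.swap i i') (Equiv.swap i i' a) (Equiv.swap i i' l) else 0) =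
    if a = i ∧ l = i' then 1 else if a = i' ∧ l = i then -1 else 0 := by
  have hlt : i < i' := by omega
  have hne : π i ≠ π i' := fun h => hlt.ne (π.injective h)
  have hadj (ρ : Equiv.Perm (Fin n)) := isCoverAt_of_lt (π := ρ) hi
  by_cases h1 : a = i ∧ l = i'
  · obtain ⟨rfl, rfl⟩ := h1
    simp only [monkSign, hadj, Equiv.swap_apply_left, Equiv.swap_apply_right,
      Equiv.Perm.mul_apply, hlt, hlt.not_gt, true_and, false_and, if_true, if_false]
    rcases lt_or_gt_of_ne hne with h | h <;> simp [h, h.not_gt]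
  by_cases h2 : a = i' ∧ l = i
  · obtain ⟨rfl, rfl⟩ := h2
    rw [if_neg h1]
    simp only [monkSign, hadj, Equiv.swap_apply_left, Equiv.swap_apply_right,
      Equiv.Perm.mul_apply, hlt, hlt.not_gt, true_and, false_and, if_true, if_false, and_self]
    rcases lt_or_gt_of_ne hne with h | h <;> simp [h, h.not_gt]
  rw [if_neg h1, if_neg h2, sub_eq_zero]
  rcases lt_trichotomy a l with hal | rfl | hal
  · have h3 := isCoverAt_and_descent_iff (π := π) hi hal h1
    have h4 := swap_lt_swap_iff hi hal h1
    simp only [monkSign, hal, h4, hal.not_gt, h4.not_gt, true_and, false_and, if_false]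
    split_ifs <;> first | rfl | tauto
  · simp [monkSign_self]
  · have h2' : ¬ (l = i ∧ a = i') := fun h => h2 h.symm
    have h3 := isCoverAt_and_descent_iff (π := π) hi hal h2'
    have h4 := swap_lt_swap_iff hi hal h2'
    rw [Equiv.swap_comm a l]
    simp only [monkSign, hal, h4, hal.not_gt, h4.not_gt, true_and, false_and, if_false]
    split_ifs <;> first | rfl | tauto

theorem sum_ite_pair (i i' a : Fin n) (h : i ≠ i') (c : Fin n → R) :
    ∑ l, (if a = i ∧ l = i' then 1 else if a = i' ∧ l = i then -1 else 0) * c l =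
      if a = i then c i' else if a = i' then - c i else 0 := by
  by_cases h1 : a = i
  · subst h1
    simp [h]
  · by_cases h2 : a = i'
    · subst h2
      simp [h1]
    · simp [h1, h2]

theorem monkDefect_swap (π : Equiv.Perm (Fin n)) (a : Fin n) (x : Fin n → R) {i i' : Fin n}
    (hi : (i : ℕ) + 1 = i') :
    monkDefect π a x = monkDefect π a (x ∘ Equiv.swap i i') +
      if π i' < π i then (x i - x i') *
        monkDefect (π * Equiv.swap i i') (Equiv.swap i i' a) (x ∘ Equiv.swap i i') else 0 := by
  classical
  have hne : i ≠ i' := by omega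
  set s := Equiv.swap i i' with hs
  set y := x ∘ s with hy
  have hperm (l : Fin n) : π * s * Equiv.swap (s a) (s l) = π * Equiv.swap a l * s := by
    rw [mul_assoc, Equiv.mul_swap_eq_swap_mul, ← mul_assoc]
    simp [hs]
  have hxy : y (s a) = x a := by simp [hy, hs]
  have key := sum_ite_pair i i' a hne fun l => bpdSum (π * Equiv.swap a l * s) y
  simp only [← monkSign_swap (R := R) π hi, sub_mul, Finset.sum_sub_distrib] at key
  have h1 : ∑ l, monkSign R π a l * bpdSum (π * Equiv.swap a l) x =
      ∑ l, monkSign R π a l * bpdSum (π * Equiv.swap a l) y + (x i - x i') *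
        ∑ l, (if (π * Equiv.swap a l) i' < (π * Equiv.swap a l) i then monkSign R π a l else 0) *
          bpdSum (π * Equiv.swap a l * s) y := by
    rw [Finset.mul_sum, ← Finset.sum_add_distrib]
    refine Finset.sum_congr rfl fun l _ => ?_
    rw [bpdSum_swap _ x hi]
    split_ifs <;> ring
  have h2 : monkDefect (π * s) (s a) y = x a * bpdSum (π * s) y -
      ∑ l, monkSign R (π * s) (s a) (s l) * bpdSum (π * Equiv.swap a l * s) y := by
    rw [monkDefect, hxy, ← Equiv.sum_comp s]
    simp only [hperm]
  rw [monkDefect, monkDefect, h1, h2, bpdSum_swap π x hi]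
  -- If `a` and `l` are the exchanged positions, then `π * Equiv.swap a l * s = π`; the exceptional
  -- terms of `monkSign_swap` thus compensate the change from `x a` to `y a`.
  have h3 : (x a - y a) * bpdSum π y = (x i - x i') *
      (if a = i then bpdSum (π * Equiv.swap a i' * s) y
        else if a = i' then -bpdSum (π * Equiv.swap a i * s) y else 0) := by
    by_cases ha : a = i
    · subst ha
      simp [hy, hs, mul_assoc]
    · by_cases ha' : a = i'
      · subst ha'
        rw [if_neg ha, if_pos rfl, Equiv.swap_comm a i, mul_assoc, ← hs, hs, Equiv.swap_mul_self]
        simp [hy, hs]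
        ring
      · simp [hy, hs, ha, ha', Equiv.swap_apply_of_ne_of_ne]
  rw [← key] at h3
  split_ifs at h3 ⊢
  · linear_combination h3
  · simp only [zero_mul, Finset.sum_const_zero, sub_zero] at h3
    linear_combination h3

theorem monkDefect_congr {π : Equiv.Perm (Fin n)} {a : Fin n} (ha : (a : ℕ) + 1 ≠ n)
    {x y : Fin n → R} (h : ∀ i : Fin n, (i : ℕ) + 1 ≠ n → x i = y i) :
    monkDefect π a x = monkDefect π a y := by
  rw [monkDefect, monkDefect, h a ha, bpdSum_congr π h]
  simp only [bpdSum_congr _ h]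

/-- A product with nonzero sign has an inversion at `a` and `l`, so it is not the identity and
`bpdSum_zero` applies. -/
theorem monkDefect_zero (π : Equiv.Perm (Fin n)) (a : Fin n) :
    monkDefect π a (0 : Fin n → R) = 0 := by
  rw [monkDefect, Pi.zero_apply, zero_mul, zero_sub, neg_eq_zero]
  refine Finset.sum_eq_zero fun l _ => ?_
  rw [monkSign]
  have hone (h : π * Equiv.swap a l = 1) : π a = l ∧ π l = a := by
    rw [mul_eq_one_iff_eq_inv, Equiv.swap_inv] at h
    simp [h]
  split_ifs with h1 h2
  · rw [bpdSum_zero, mul_zero]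
    intro h
    have := h1.2.1
    rw [(hone h).1, (hone h).2] at this
    exact lt_asymm this h1.1
  · rw [bpdSum_zero, mul_zero]
    intro h
    have := h2.2.1
    rw [(hone h).1, (hone h).2] at this
    exact lt_asymm this h2.1
  · rw [zero_mul]

/-- A function that is symmetric and does not depend on the last variable is constant. -/
theorem eq_apply_zero_of_symmetric {f : (Fin n → R) → R}
    (hsymm : ∀ i i' : Fin n, (i : ℕ) + 1 = i' → ∀ x, f (x ∘ Equiv.swap i i') = f x)
    (hlast : ∀ x y : Fin n → R, (∀ i : Fin n, (i : ℕ) + 1 ≠ n → x i = y i) → f x = f y)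
    (x : Fin n → R) : f x = f 0 := by
  classical
  have h1 : ∀ m : ℕ, ∀ j : Fin n, (j : ℕ) + m + 1 = n → ∀ x, f (Function.update x j 0) = f x := by
    intro m
    induction m with
    | zero =>
      intro j hj x
      refine hlast _ _ fun i hi => Function.update_of_ne ?_ _ _
      omega
    | succ m ih =>
      intro j hj x
      obtain ⟨j', hj'⟩ : ∃ j' : Fin n, (j : ℕ) + 1 = j' := ⟨⟨j + 1, by omega⟩, rfl⟩
      -- The variable is carried to position `j'`, set to zero there by induction, and carried back.
      rw [← hsymm j j' hj' x, ← ih j' (by omega) (x ∘ _), ← hsymm j j' hj' (Function.update x j 0)]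
      congr 1
      funext i
      simp only [Function.comp, Function.update_apply, Equiv.swap_apply_def]
      grind
  have h2 (A : Finset (Fin n)) : f (fun i => if i ∈ A then 0 else x i) = f x := by
    induction A using Finset.induction with
    | empty => simp
    | insert a A _ ih =>
      rw [← ih, ← h1 (n - 1 - a) a (by omega) (fun i => if i ∈ A then 0 else x i)]
      congr 1
      funext i
      by_cases hi : i = a <;> simp [hi]
  rw [← h2 Finset.univ]
  congr 1
  funext i
  simp

/-- At a descent the correction term in `monkDefect_swap` belongs to a shorter permutation. The
ascent at `(a, l)` survives the exchange, since `(a, l)` is not the descending pair `(i, i')`; it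
also keeps `a` away from the last row. -/
theorem monkDefect_eq_zero {π : Equiv.Perm (Fin n)} {a : Fin n}
    (h : ∃ l, a < l ∧ π a < π l) (x : Fin n → R) : monkDefect π a x = 0 := by
  induction hm : permLength π using Nat.strong_induction_on generalizing π a x with
  | _ m ih =>
    subst hm
    rw [eq_apply_zero_of_symmetric (f := monkDefect π a) _ _ x, monkDefect_zero]
    · intro i i' hi x
      rw [monkDefect_swap π a x hi]
      split_ifs with hd
      · obtain ⟨l, hal, hπ⟩ := h
        have hne : ¬ (a = i ∧ l = i') := by
          rintro ⟨rfl, rfl⟩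
          exact lt_asymm hd hπ
        have hlt : permLength (π * Equiv.swap i i') < permLength π := by
          have := permLength_lt (π := π * Equiv.swap i i') (k := i) (l := i') (by omega)
            (by simpa using hd)
          rwa [mul_assoc, Equiv.swap_mul_self, mul_one] at this
        rw [ih _ hlt ⟨Equiv.swap i i' l, swap_lt_swap_iff hi hal hne, by simpa using hπ⟩ _ rfl,
          mul_zero, add_zero]
      · rw [add_zero]
    · intro x y hxy
      obtain ⟨l, hal, -⟩ := h
      exact monkDefect_congr (by omega) hxy

open Classical in
/-- Monk's rule for the generating functions of bumpless pipe dreams. -/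
theorem bpdSum_monk {π : Equiv.Perm (Fin n)} {a : Fin n}
    (h : ∃ l, a < l ∧ BruhatCovBy π (π * Equiv.swap a l)) (x : Fin n → R) :
    x a * bpdSum π x +
        ∑ k ∈ Finset.univ.filter (fun k => k < a ∧ BruhatCovBy π (π * Equiv.swap k a)),
          bpdSum (π * Equiv.swap k a) x =
      ∑ l ∈ Finset.univ.filter (fun l => a < l ∧ BruhatCovBy π (π * Equiv.swap a l)),
        bpdSum (π * Equiv.swap a l) x := by
  have h0 : monkDefect π a x = 0 := by
    obtain ⟨l, hal, hl⟩ := h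
    exact monkDefect_eq_zero ⟨l, hal, ((bruhatCovBy_mul_swap_iff hal).1 hl).1⟩ x
  rw [monkDefect, sub_eq_zero] at h0
  rw [h0, Finset.sum_filter, Finset.sum_filter, ← Finset.sum_add_distrib]
  refine Finset.sum_congr rfl fun l _ => ?_
  rw [monkSign, Equiv.swap_comm l a]
  rcases lt_trichotomy a l with hal | rfl | hal
  · rw [bruhatCovBy_mul_swap_iff hal]
    simp [hal, hal.not_gt]
  · simp
  · rw [Equiv.swap_comm a l, bruhatCovBy_mul_swap_iff hal]
    simp only [hal, hal.not_gt, true_and, false_and, if_false]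
    split_ifs <;> ring

/-- Families of monomials with the same sum correspond to each other. -/
theorem exists_equiv_of_sum_monomial_eq {σ A B : Type*} [Fintype A] [Fintype B]
    (f : A → σ →₀ ℕ) (g : B → σ →₀ ℕ)
    (h : ∑ a, MvPolynomial.monomial (f a) (1 : ℤ) = ∑ b, MvPolynomial.monomial (g b) 1) :
    ∃ e : A ≃ B, ∀ a, g (e a) = f a := by
  classical
  have hcard (d : σ →₀ ℕ) : Nonempty ({a // f a = d} ≃ {b // g b = d}) := by
    have := congrArg (MvPolynomial.coeff d) h
    simp only [MvPolynomial.coeff_sum, MvPolynomial.coeff_monomial, Finset.sum_boole,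
      Nat.cast_inj] at this
    rw [← Fintype.card_subtype, ← Fintype.card_subtype] at this
    exact ⟨Fintype.equivOfCardEq this⟩
  exact ⟨Equiv.ofFiberEquiv fun d => (hcard d).some, fun a => Equiv.ofFiberEquiv_map _ a⟩

/-- The numbers of blank tiles in the rows as an exponent vector. -/
noncomputable def BPDTiling.blankExponent (T : BPDTiling n) : Fin n →₀ ℕ :=
  Finsupp.equivFunOnFinite.symm T.rowBlanks

theorem BPDTiling.prod_blank_X (T : BPDTiling n) :
    ∏ c ∈ T.blank, (MvPolynomial.X c.1 : MvPolynomial (Fin n) ℤ) =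
      MvPolynomial.monomial T.blankExponent 1 := by
  rw [MvPolynomial.monomial_eq, map_one, one_mul, Finsupp.prod_fintype _ _ fun i => pow_zero _,
    BPDTiling.blank, Finset.prod_filter, Fintype.prod_prod_type]
  refine Finset.prod_congr rfl fun i _ => ?_
  rw [← Finset.prod_filter]
  exact Finset.prod_const (MvPolynomial.X i)

open Classical in
theorem bpdSchubert_eq_sum_monomial (π : Equiv.Perm (Fin n)) :
    bpdSchubert π = ∑ D : BPD π, MvPolynomial.monomial D.1.blankExponent 1 := by
  rw [bpdSchubert, Finset.sum_subtype (p := (· ∈ BPD π)) _ (by simp)]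
  exact Finset.sum_congr rfl fun D _ => D.1.prod_blank_X

end Monk

open Classical in
theorem mainTheorem1 {n : ℕ} (π : Equiv.Perm (Fin n)) (α : Fin n)
    (hα : ∃ l : Fin n, α < l ∧ BruhatCovBy π (π * Equiv.swap α l)) :
    (∃ Φ : (BPD π ⊕
          (Σ k : {k : Fin n // k < α ∧ BruhatCovBy π (π * Equiv.swap k α)},
            BPD (π * Equiv.swap (k : Fin n) α))) ≃
        (Σ l : {l : Fin n // α < l ∧ BruhatCovBy π (π * Equiv.swap α l)},
          BPD (π * Equiv.swap α (l : Fin n))),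
      (∀ D : BPD π,
        (∀ i : Fin n, i ≠ α →
          (Φ (Sum.inl D)).2.1.rowBlanks i = D.1.rowBlanks i) ∧
        (Φ (Sum.inl D)).2.1.rowBlanks α = D.1.rowBlanks α + 1) ∧
      (∀ (k : {k : Fin n // k < α ∧ BruhatCovBy π (π * Equiv.swap k α)})
          (D : BPD (π * Equiv.swap (k : Fin n) α)) (i : Fin n),
        (Φ (Sum.inr ⟨k, D⟩)).2.1.rowBlanks i = D.1.rowBlanks i)) ∧
    MvPolynomial.X α * bpdSchubert π +
        ∑ k ∈ Finset.univ.filter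
            (fun k : Fin n => k < α ∧ BruhatCovBy π (π * Equiv.swap k α)),
          bpdSchubert (π * Equiv.swap k α) =
      ∑ l ∈ Finset.univ.filter
          (fun l : Fin n => α < l ∧ BruhatCovBy π (π * Equiv.swap α l)),
        bpdSchubert (π * Equiv.swap α l) := by
  have hmonk := bpdSum_monk hα (MvPolynomial.X : Fin n → MvPolynomial (Fin n) ℤ)
  refine ⟨?_, hmonk⟩
  change MvPolynomial.X α * bpdSchubert π + ∑ k ∈ _, bpdSchubert _ =
    ∑ l ∈ _, bpdSchubert _ at hmonk
  rw [Finset.sum_subtype (p := fun k => k < α ∧ BruhatCovBy π (π * Equiv.swap k α)) _ (by simp),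
    Finset.sum_subtype (p := fun l => α < l ∧ BruhatCovBy π (π * Equiv.swap α l)) _ (by simp)]
    at hmonk
  simp only [bpdSchubert_eq_sum_monomial, Finset.mul_sum] at hmonk
  -- The factor `X α` becomes the summand `Finsupp.single α 1`, so equality of exponent vectors is
  -- the claim on blanks row by row.
  obtain ⟨Φ, hΦ⟩ := exists_equiv_of_sum_monomial_eq
    (Sum.elim (fun D : BPD π => Finsupp.single α 1 + D.1.blankExponent)
      (fun D : (Σ k : {k : Fin n // k < α ∧ BruhatCovBy π (π * Equiv.swap k α)},
            BPD (π * Equiv.swap (k : Fin n) α)) => D.2.1.blankExponent))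
    (fun D : (Σ l : {l : Fin n // α < l ∧ BruhatCovBy π (π * Equiv.swap α l)},
          BPD (π * Equiv.swap α (l : Fin n))) => D.2.1.blankExponent)
    (by
      rw [Fintype.sum_sum_type, Fintype.sum_sigma, Fintype.sum_sigma, ← hmonk]
      congr 1
      refine Finset.sum_congr rfl fun D _ => ?_
      rw [Sum.elim_inl, MvPolynomial.X, MvPolynomial.monomial_mul, one_mul])
  have hinl (D : BPD π) (i : Fin n) : (Φ (Sum.inl D)).2.1.rowBlanks i =
      Finsupp.single α 1 i + D.1.rowBlanks i := DFunLike.congr_fun (hΦ (.inl D)) i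
  refine ⟨Φ, fun D => ⟨fun i hi => ?_, ?_⟩, fun k D i => DFunLike.congr_fun (hΦ (.inr ⟨k, D⟩)) i⟩
  · rw [hinl, Finsupp.single_eq_of_ne hi, zero_add]
  · rw [hinl, Finsupp.single_eq_same, add_comm]
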